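/- Let $m,n\ge 1$ be integers and $0<\alpha<mn$. For $\vec f=(f_1,\dots,f_m)$ with each $f_i$ a locally integrable (real- or complex-valued) function on $\mathbb R^n$, put $$\mathcal I_\alpha(\vec f)(x)=\int_{(\mathbb R^n)^m}\frac{\prod_{i=1}^m f_i(x-y_i)}{(|y_1|+\cdots+|y_m|)^{mn-\alpha}}\,dy_1\cdots dy_m,\qquad \mathcal M_\alpha(\vec f)(x)=\sup_{Q\ni x}\prod_{i=1}^m\frac{1}{|Q|^{1-\frac{\alpha}{mn}}}\int_Q|f_i(y)|\,dy,$$ where the supremum is over all cubes $Q\subset\mathbb R^n$ containing $x$ with sides parallel to the coordinate axes, and $|\mathcal I_\alpha(\vec f)(x)|$ is understood as $+\infty$ where the integral does not converge absolutely. Let $\omega\in A_\infty=\bigcup_{1<p<\infty}A_p$, where $A_p$ is the class of nonnegative locally integrable functions $\omega$ on $\mathbb R^n$ with $$\sup_Q\Big(\frac1{|Q|}\int_Q\omega\,dx\Big)\Big(\frac1{|Q|}\int_Q\omega^{-\frac1{p-1}}\,dx\Big)^{p-1}<\infty ,$$ the supremum being over all such cubes (with $0^{-1/(p-1)}=\infty$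 and $0\cdot\infty=0$). Write $\omega(E)=\int_E\omega\,dx$. **Proposition 5.1.** Let $0<q<\infty$, $0<\alpha<mn$ and $\omega\in A_\infty$. Then there exists a positive constant $C$, independent of $\vec f$, such that for all $\vec f$ as above $$\int_{\mathbb R^n}|\mathcal I_\alpha(\vec f)(x)|^q\,\omega(x)\,dx\le C\int_{\mathbb R^n}[\mathcal M_\alpha(\vec f)(x)]^q\,\omega(x)\,dx$$ and $$\sup_{\lambda>0}\lambda^q\,\omega(\{x\in\mathbb R^n:|\mathcal I_\alpha(\vec f)(x)|>\lambda\})\le C\,\sup_{\lambda>0}\lambda^q\,\omega(\{x\in\mathbb R^n:\mathcal M_\alpha(\vec f)(x)>\lambda\}).$$ -/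

import Mathlib

open MeasureTheory
open scoped ENNReal

noncomputable section

/-- The closed cube of side length `l` with sides parallel to the coordinate axes whose
lower corner is `a`. It is used for `0 < l` only. -/
def axisCube {n : ℕ} (a : EuclideanSpace ℝ (Fin n)) (l : ℝ) : Set (EuclideanSpace ℝ (Fin n)) :=
  {x | ∀ j, a j ≤ x j ∧ x j ≤ a j + l}

/-- The integrand `∏ i, f i (x - y i) / |(y_1, …, y_m)| ^ (m n - α)` of the multilinear fractional
integral, where `|(y_1, …, y_m)| = |y_1| + ⋯ + |y_m|` with Euclidean norms. -/
def fracKernel {𝕜 : Type*} [RCLike 𝕜] {m n : ℕ} (α : ℝ)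
    (f : Fin m → EuclideanSpace ℝ (Fin n) → 𝕜) (x : EuclideanSpace ℝ (Fin n))
    (y : Fin m → EuclideanSpace ℝ (Fin n)) : 𝕜 :=
  (∏ i, f i (x - y i)) / (((∑ i, ‖y i‖) ^ ((m : ℝ) * n - α) : ℝ) : 𝕜)

/-- The multilinear fractional integral `I_α f (x)`, where the integral over `(ℝⁿ)^m` converges
absolutely. -/
def fracIntegral {𝕜 : Type*} [RCLike 𝕜] {m n : ℕ} (α : ℝ)
    (f : Fin m → EuclideanSpace ℝ (Fin n) → 𝕜) (x : EuclideanSpace ℝ (Fin n)) : 𝕜 :=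
  ∫ y : Fin m → EuclideanSpace ℝ (Fin n), fracKernel α f x y

open Classical in
/-- `|I_α f (x)|` as an element of `[0, ∞]`. It is `∞` where the integral does not converge
absolutely, so that it is the usual extended value of `I_α f (x)` for every nonnegative `f`,
and divergence is never counted as the value `0`. -/
def fracIntegralAbs {𝕜 : Type*} [RCLike 𝕜] {m n : ℕ} (α : ℝ)
    (f : Fin m → EuclideanSpace ℝ (Fin n) → 𝕜) (x : EuclideanSpace ℝ (Fin n)) : ℝ≥0∞ :=
  if Integrable (fracKernel α f x) volume then ‖fracIntegral α f x‖ₑ else ∞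

/-- The multilinear fractional maximal operator: the supremum, over all axis-parallel cubes `Q`
containing `x`, of `∏ i, |Q| ^ (-(1 - α / (m n))) ∫_Q |f i|`. -/
def fracMaximal {𝕜 : Type*} [RCLike 𝕜] {m n : ℕ} (α : ℝ)
    (f : Fin m → EuclideanSpace ℝ (Fin n) → 𝕜) (x : EuclideanSpace ℝ (Fin n)) : ℝ≥0∞ :=
  ⨆ (a : EuclideanSpace ℝ (Fin n)) (l : ℝ) (_ : 0 < l) (_ : x ∈ axisCube a l),
    ∏ i, (∫⁻ y in axisCube a l, ‖f i y‖ₑ) / volume (axisCube a l) ^ (1 - α / ((m : ℝ) * n))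

/-- The Muckenhoupt class `A_p`, `1 < p < ∞`: nonnegative locally integrable `ω` with
`sup_Q (⨍_Q ω) (⨍_Q ω ^ (-1 / (p - 1))) ^ (p - 1) < ∞`, the supremum being over axis-parallel
cubes. Powers are taken in `[0, ∞]`, so `0` to a negative power is `∞`. -/
structure IsApWeight {n : ℕ} (p : ℝ) (ω : EuclideanSpace ℝ (Fin n) → ℝ) : Prop where
  nonneg : ∀ x, 0 ≤ ω x
  locallyIntegrable : LocallyIntegrable ω volume
  bound : ∃ K : ℝ≥0∞, K < ∞ ∧ ∀ (a : EuclideanSpace ℝ (Fin n)) (l : ℝ), 0 < l →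
    ((∫⁻ x in axisCube a l, ENNReal.ofReal (ω x)) / volume (axisCube a l)) *
      ((∫⁻ x in axisCube a l, ENNReal.ofReal (ω x) ^ (-1 / (p - 1))) /
        volume (axisCube a l)) ^ (p - 1) ≤ K

/-- The class `A_∞`, the union of the classes `A_p` over `1 < p < ∞`. -/
def IsAInftyWeight {n : ℕ} (ω : EuclideanSpace ℝ (Fin n) → ℝ) : Prop :=
  ∃ p : ℝ, 1 < p ∧ IsApWeight p ω

/-- The measure `ω(x) dx`. -/
def weightMeasure {n : ℕ} (ω : EuclideanSpace ℝ (Fin n) → ℝ) :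
    Measure (EuclideanSpace ℝ (Fin n)) :=
  volume.withDensity fun x => ENNReal.ofReal (ω x)

/-- The `q`-th power of the weak `L^{q,∞}(μ)` quasinorm of a nonnegative function:
`sup_{t > 0} t ^ q μ {x | g x > t}`. -/
def weakQuasinormPow {X : Type*} [MeasurableSpace X] (q : ℝ) (g : X → ℝ≥0∞) (μ : Measure X) :
    ℝ≥0∞ :=
  ⨆ (t : ℝ) (_ : 0 < t), ENNReal.ofReal t ^ q * μ {x | ENNReal.ofReal t < g x}

end

/-!
The fractional integral `I_α f` is compared with a dyadic model operator, for which a good-λ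
inequality is available without any covering theorem.

*Discretization.* Put `β = m n - α` and let `ν_l` be the measure `|f_l(x)| dx`. Splitting the kernel
into the shells `|y_1| + ⋯ + |y_m| ~ 2 ^ k` gives `|I_α f| ≤ 2 ^ β T` with
`T = ∑_Q c_Q 1_Q`, the sum being over all dyadic cubes `Q`, where
`c_Q = ℓ(Q) ^ (-β) ∏ l, ν_l (3Q)` (`fracIntegralAbs_le_iSup_familySum`). As `3Q` is a cube
containing `Q`, one has `c_Q ≤ 3 ^ β M_α f` on `Q` (`familyMax_le_fracMaximal`). It remains to
control `T` by `max_Q c_Q 1_Q`, and by monotone convergence only finitely many cubes need to be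
kept, uniformly in their choice. This truncation makes all quantities finite a priori.

*Local estimate.* Below a fixed cube `P` the sum satisfies
`∫_P (∑_{Q ⊆ P} c_Q 1_Q) ^ (1 / m) ≤ C |P| c_P ^ (1 / m)` (`setLIntegral_familySum_rpow_le`).
The `m`-th root is subadditive and, generation by generation, Hölder's inequality with `m` equal
exponents and Tonelli's theorem leave a geometric series, whose ratio is below `1` because `0 < α`.
By Chebyshev's inequality the local sum exceeds `t` on at most half of `P` once `c_P ≤ κ t`.

*Good-λ.* The set `{T > t}` is a disjoint union of stopping cubes `P`, and the part of `T` coming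
from cubes strictly above `P` is at most `t`. Hence `T > (1 + s) t` forces the local sum over `P` to
exceed `s t`, which for small `max_Q c_Q 1_Q` happens on at most half of `P`
(`IsNested.goodLambda`).

*Weight.* By Hölder's inequality the `A_p` condition says that a subset of half the volume of a cube
carries at most `1 - θ` of its weight (`IsAInftyWeight.exists_measure_le`). No reverse Hölder
inequality is needed: with `a = 1 + s` and `a ^ q = 1 + θ` the product `a ^ q (1 - θ)` is below `1`,
so that integrating the good-λ inequality (`goodLambda_bounds`) allows absorption, in the strong and
in the weak form alike.
-/

/-! ### From good-λ inequalities to strong and weak type bounds -/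

/-- **Integrated form of a good-λ inequality**, by the layer-cake formula. -/
theorem lintegral_rpow_le_of_meas_lt_le {X : Type*} [MeasurableSpace X] {μ : Measure X}
    {f g h : X → ℝ} (hf0 : ∀ x, 0 ≤ f x) (hg0 : ∀ x, 0 ≤ g x) (hh0 : ∀ x, 0 ≤ h x)
    (hf : Measurable f) (hg : Measurable g) (hh : Measurable h) {ε : ℝ≥0∞} {q : ℝ} (hq : 0 < q)
    (hle : ∀ t : ℝ, 0 < t → μ {x | t < f x} ≤ ε * μ {x | t < g x} + μ {x | t < h x}) :
    ∫⁻ x, ENNReal.ofReal (f x ^ q) ∂μ ≤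
      ε * ∫⁻ x, ENNReal.ofReal (g x ^ q) ∂μ + ∫⁻ x, ENNReal.ofReal (h x ^ q) ∂μ := by
  have meas : ∀ u : X → ℝ, Measurable fun t : ℝ => μ {x | t < u x} := fun u =>
    Antitone.measurable fun s t hst => measure_mono fun x (hx : t < u x) => hst.trans_lt hx
  have mpow : Measurable fun t : ℝ => ENNReal.ofReal (t ^ (q - 1)) := by fun_prop
  have mgp : Measurable fun t : ℝ => μ {x | t < g x} * ENNReal.ofReal (t ^ (q - 1)) :=
    (meas g).mul mpow
  rw [lintegral_rpow_eq_lintegral_meas_lt_mul μ (ae_of_all _ hf0) hf.aemeasurable hq,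
    lintegral_rpow_eq_lintegral_meas_lt_mul μ (ae_of_all _ hg0) hg.aemeasurable hq,
    lintegral_rpow_eq_lintegral_meas_lt_mul μ (ae_of_all _ hh0) hh.aemeasurable hq,
    mul_left_comm ε, ← mul_add, ← lintegral_const_mul _ mgp, ← lintegral_add_left (mgp.const_mul _)]
  gcongr _ * ?_
  refine setLIntegral_mono' measurableSet_Ioi fun t ht => ?_
  rw [← mul_assoc, ← add_mul]
  gcongr
  exact hle t ht

theorem ENNReal.ofReal_toReal_div_rpow {u : ℝ≥0∞} (hu : u ≠ ∞) {b q : ℝ} (hb : 0 < b)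
    (hq : 0 < q) :
    ENNReal.ofReal ((u.toReal / b) ^ q) = u ^ q / ENNReal.ofReal b ^ q := by
  rw [← ENNReal.ofReal_rpow_of_nonneg (by positivity) hq.le, ENNReal.ofReal_div_of_pos hb,
    ENNReal.ofReal_toReal hu, ENNReal.div_rpow_of_nonneg _ _ hq.le]

theorem ENNReal.lt_toReal_div_iff {u : ℝ≥0∞} (hu : u ≠ ∞) {b t : ℝ} (hb : 0 < b) (ht : 0 < t) :
    t < u.toReal / b ↔ ENNReal.ofReal (b * t) < u := by
  rw [lt_div_iff₀ hb, ENNReal.ofReal_lt_iff_lt_toReal (by positivity) hu, mul_comm]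

/-- Absorption: in `A ≤ κ A + D` with `κ < 1` a finite `A` can be moved to the left. -/
theorem ENNReal.le_of_le_mul_add {A D : ℝ≥0∞} {θ : ℝ} (hθ : 0 < θ) (hθ1 : θ ≤ 1)
    (hA : A ≠ ∞) (h : A ≤ ENNReal.ofReal (1 - θ) * A + D) : A ≤ ENNReal.ofReal (1 / θ) * D := by
  have h1 : ENNReal.ofReal (1 - θ) * A + ENNReal.ofReal θ * A = A := by
    rw [← add_mul, ← ENNReal.ofReal_add (by linarith) hθ.le]; simp
  have h2 : ENNReal.ofReal θ * A ≤ D := by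
    have hfin : ENNReal.ofReal (1 - θ) * A ≠ ∞ := ENNReal.mul_ne_top ENNReal.ofReal_ne_top hA
    rw [← ENNReal.add_le_add_iff_left hfin, h1]
    exact h
  calc A = ENNReal.ofReal (1 / θ) * (ENNReal.ofReal θ * A) := by
        rw [← mul_assoc, ← ENNReal.ofReal_mul (by positivity), one_div_mul_cancel hθ.ne']; simp
    _ ≤ _ := by gcongr

/-- From good-λ to the strong and weak type bounds of exponent `q`. The a priori finiteness of
`∫ u ^ q` is what permits the absorption. -/
theorem goodLambda_bounds {X : Type*} [MeasurableSpace X] {μ : Measure X} {u v : X → ℝ≥0∞}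
    (hu : Measurable u) (hv : Measurable v) (hu' : ∀ x, u x ≠ ∞) (hv' : ∀ x, v x ≠ ∞)
    {q : ℝ} (hq : 0 < q) (hfin : ∫⁻ x, u x ^ q ∂μ ≠ ∞) {a γ ε θ : ℝ} (ha : 0 < a) (hγ : 0 < γ)
    (hθ : 0 < θ) (hθ1 : θ ≤ 1) (haε : a ^ q * ε ≤ 1 - θ)
    (hgl : ∀ t : ℝ, 0 < t → μ {x | ENNReal.ofReal (a * t) < u x} ≤
      ENNReal.ofReal ε * μ {x | ENNReal.ofReal t < u x} + μ {x | ENNReal.ofReal (γ * t) < v x}) :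
    ∫⁻ x, u x ^ q ∂μ ≤ ENNReal.ofReal (1 / θ * (a / γ) ^ q) * ∫⁻ x, v x ^ q ∂μ ∧
      weakQuasinormPow q u μ ≤ ENNReal.ofReal (1 / θ * (a / γ) ^ q) * weakQuasinormPow q v μ := by
  have haq : ENNReal.ofReal a ^ q = ENNReal.ofReal (a ^ q) := ENNReal.ofReal_rpow_of_pos ha
  have hq0 : ENNReal.ofReal (a ^ q) ≠ 0 := by
    simp only [ne_eq, ENNReal.ofReal_eq_zero, not_le]; positivity
  have hfac : ENNReal.ofReal (a ^ q) * ENNReal.ofReal ε ≤ ENNReal.ofReal (1 - θ) := by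
    rw [← ENNReal.ofReal_mul (by positivity)]
    exact ENNReal.ofReal_le_ofReal haε
  have hdiv : ENNReal.ofReal ((a / γ) ^ q) = ENNReal.ofReal (a ^ q) / ENNReal.ofReal γ ^ q := by
    rw [ENNReal.ofReal_rpow_of_pos hγ, Real.div_rpow ha.le hγ.le,
      ENNReal.ofReal_div_of_pos (by positivity)]
  have hsplit : ENNReal.ofReal (1 / θ * (a / γ) ^ q) =
      ENNReal.ofReal (1 / θ) * ENNReal.ofReal ((a / γ) ^ q) :=
    ENNReal.ofReal_mul (by positivity)
  constructor
  · have key := lintegral_rpow_le_of_meas_lt_le (μ := μ) (f := fun x => (u x).toReal / a)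
      (g := fun x => (u x).toReal / 1) (h := fun x => (v x).toReal / γ) (fun x => by positivity)
      (fun x => by positivity) (fun x => by positivity) (by fun_prop) (by fun_prop) (by fun_prop)
      (ε := ENNReal.ofReal ε) hq (fun t ht => by
        simpa only [ENNReal.lt_toReal_div_iff (hu' _) ha ht,
          ENNReal.lt_toReal_div_iff (hv' _) hγ ht,
          ENNReal.lt_toReal_div_iff (hu' _) one_pos ht, one_mul] using hgl t ht)
    simp only [ENNReal.ofReal_toReal_div_rpow (hu' _) ha hq,
      ENNReal.ofReal_toReal_div_rpow (hu' _) one_pos hq,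
      ENNReal.ofReal_toReal_div_rpow (hv' _) hγ hq] at key
    simp only [div_eq_mul_inv, ENNReal.ofReal_one, ENNReal.one_rpow, inv_one, mul_one] at key
    rw [lintegral_mul_const _ (hu.pow_const q), lintegral_mul_const _ (hv.pow_const q), haq] at key
    rw [hsplit, mul_assoc]
    refine ENNReal.le_of_le_mul_add hθ hθ1 hfin ?_
    set A := ∫⁻ x, u x ^ q ∂μ
    set B := ∫⁻ x, v x ^ q ∂μ
    calc A = ENNReal.ofReal (a ^ q) * (A * (ENNReal.ofReal (a ^ q))⁻¹) := by
          rw [mul_comm A, ← mul_assoc, ENNReal.mul_inv_cancel hq0 ENNReal.ofReal_ne_top, one_mul]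
      _ ≤ ENNReal.ofReal (a ^ q) * (ENNReal.ofReal ε * A + B * (ENNReal.ofReal γ ^ q)⁻¹) := by
          gcongr
      _ = ENNReal.ofReal (a ^ q) * ENNReal.ofReal ε * A + ENNReal.ofReal ((a / γ) ^ q) * B := by
          rw [hdiv, div_eq_mul_inv]; ring
      _ ≤ _ := by gcongr
  · have hW : weakQuasinormPow q u μ ≠ ∞ := by
      refine ne_top_of_le_ne_top hfin (iSup₂_le fun t _ => ?_)
      refine le_trans ?_ (mul_meas_ge_le_lintegral (hu.pow_const q) (ENNReal.ofReal t ^ q))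
      gcongr with x
      exact fun hx => ENNReal.rpow_le_rpow hx.le hq.le
    rw [hsplit, mul_assoc]
    refine ENNReal.le_of_le_mul_add hθ hθ1 hW (iSup₂_le fun s hs => ?_)
    obtain ⟨t, ht, rfl⟩ : ∃ t, 0 < t ∧ s = a * t := ⟨s / a, by positivity, by field_simp⟩
    have hu1 : ENNReal.ofReal t ^ q * μ {x | ENNReal.ofReal t < u x} ≤ weakQuasinormPow q u μ :=
      le_iSup₂ (f := fun (t : ℝ) (_ : 0 < t) =>
        ENNReal.ofReal t ^ q * μ {x | ENNReal.ofReal t < u x}) t ht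
    have hv1 : ENNReal.ofReal (γ * t) ^ q * μ {x | ENNReal.ofReal (γ * t) < v x} ≤
        weakQuasinormPow q v μ :=
      le_iSup₂ (f := fun (t : ℝ) (_ : 0 < t) =>
        ENNReal.ofReal t ^ q * μ {x | ENNReal.ofReal t < v x}) (γ * t) (by positivity)
    have hγq : ENNReal.ofReal ((a / γ) ^ q) * ENNReal.ofReal (γ * t) ^ q =
        ENNReal.ofReal (a ^ q) * ENNReal.ofReal t ^ q := by
      rw [ENNReal.ofReal_rpow_of_pos (by positivity), ENNReal.ofReal_rpow_of_pos ht,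
        ← ENNReal.ofReal_mul (by positivity), ← ENNReal.ofReal_mul (by positivity),
        ← Real.mul_rpow (by positivity) (by positivity), ← Real.mul_rpow ha.le ht.le]
      congr 2
      field_simp
    calc ENNReal.ofReal (a * t) ^ q * μ {x | ENNReal.ofReal (a * t) < u x}
        ≤ ENNReal.ofReal (a * t) ^ q * (ENNReal.ofReal ε * μ {x | ENNReal.ofReal t < u x} +
            μ {x | ENNReal.ofReal (γ * t) < v x}) := by gcongr; exact hgl t ht
      _ = ENNReal.ofReal (a ^ q) * ENNReal.ofReal ε *
            (ENNReal.ofReal t ^ q * μ {x | ENNReal.ofReal t < u x}) +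
          ENNReal.ofReal ((a / γ) ^ q) *
            (ENNReal.ofReal (γ * t) ^ q * μ {x | ENNReal.ofReal (γ * t) < v x}) := by
          rw [← mul_assoc (ENNReal.ofReal ((a / γ) ^ q)), hγq, ENNReal.ofReal_mul ha.le,
            ENNReal.mul_rpow_of_nonneg _ _ hq.le, haq]
          ring
      _ ≤ _ := by gcongr

/-- A pointwise bound passes to the weak quasinorm. -/
theorem weakQuasinormPow_le_of_le_mul {X : Type*} [MeasurableSpace X] {μ : Measure X}
    {u v : X → ℝ≥0∞} {q : ℝ} (hq : 0 ≤ q) {b : ℝ} (hb : 0 < b)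
    (h : ∀ x, u x ≤ ENNReal.ofReal b * v x) :
    weakQuasinormPow q u μ ≤ ENNReal.ofReal b ^ q * weakQuasinormPow q v μ := by
  refine iSup₂_le fun s hs => ?_
  obtain ⟨t, ht, rfl⟩ : ∃ t, 0 < t ∧ s = b * t := ⟨s / b, by positivity, by field_simp⟩
  have hv1 : ENNReal.ofReal t ^ q * μ {x | ENNReal.ofReal t < v x} ≤ weakQuasinormPow q v μ :=
    le_iSup₂ (f := fun (t : ℝ) (_ : 0 < t) =>
      ENNReal.ofReal t ^ q * μ {x | ENNReal.ofReal t < v x}) t ht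
  rw [ENNReal.ofReal_mul hb.le, ENNReal.mul_rpow_of_nonneg _ _ hq, mul_assoc]
  gcongr
  refine le_trans ?_ hv1
  refine mul_le_mul' le_rfl (measure_mono fun x hx => ?_)
  have hx' : ENNReal.ofReal b * ENNReal.ofReal t < u x := hx
  exact lt_of_mul_lt_mul_left' (hx'.trans_le (h x))

theorem lintegral_rpow_le_of_le_mul {X : Type*} [MeasurableSpace X] {μ : Measure X}
    {u v : X → ℝ≥0∞} {q : ℝ} (hq : 0 ≤ q) {b : ℝ}
    (h : ∀ x, u x ≤ ENNReal.ofReal b * v x) :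
    ∫⁻ x, u x ^ q ∂μ ≤ ENNReal.ofReal b ^ q * ∫⁻ x, v x ^ q ∂μ := by
  rw [← lintegral_const_mul' _ _ (ENNReal.rpow_ne_top_of_nonneg hq ENNReal.ofReal_ne_top)]
  refine lintegral_mono fun x => ?_
  rw [← ENNReal.mul_rpow_of_nonneg _ _ hq]
  exact ENNReal.rpow_le_rpow (h x) hq

/-! ### Good-λ for nested families of sets -/

/-- A family of sets with levels, any two members of which are disjoint or nested, the one of lower
level inside the other; distinct members of the same level are disjoint. -/
def IsNested {ι X : Type*} (Q : ι → Set X) (lev : ι → ℤ) : Prop :=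
  ∀ i j x, x ∈ Q i → x ∈ Q j → lev i ≤ lev j → Q i ⊆ Q j ∧ (lev i = lev j → i = j)

/-- The positive operator `∑ i ∈ F, c i 1_{Q i}` of a finite family of sets. -/
noncomputable def familySum {ι X : Type*} (Q : ι → Set X) (c : ι → ℝ≥0∞) (F : Finset ι)
    (x : X) : ℝ≥0∞ :=
  ∑ i ∈ F, (Q i).indicator (fun _ => c i) x

/-- The maximal operator `max_{i ∈ F} c i 1_{Q i}` of a finite family of sets. -/
noncomputable def familyMax {ι X : Type*} (Q : ι → Set X) (c : ι → ℝ≥0∞) (F : Finset ι)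
    (x : X) : ℝ≥0∞ :=
  F.sup fun i => (Q i).indicator (fun _ => c i) x

section
variable {ι X : Type*} {Q : ι → Set X} {lev : ι → ℤ} {c : ι → ℝ≥0∞}

theorem measurable_familySum [MeasurableSpace X] (hQ : ∀ i, MeasurableSet (Q i)) (F : Finset ι) :
    Measurable (familySum Q c F) :=
  Finset.measurable_sum _ fun i _ => measurable_const.indicator (hQ i)

theorem measurable_familyMax [MeasurableSpace X] (hQ : ∀ i, MeasurableSet (Q i)) (F : Finset ι) :
    Measurable (familyMax Q c F) := by
  have : familyMax Q c F = F.sup fun i => (Q i).indicator (fun _ => c i) := by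
    ext x; simp [familyMax, Finset.sup_apply]
  rw [this]
  exact Finset.sup_induction measurable_const (fun _ h _ h' => h.sup h')
    fun i _ => measurable_const.indicator (hQ i)

theorem indicator_const_le_self (s : Set X) (b : ℝ≥0∞) (x : X) :
    s.indicator (fun _ => b) x ≤ b := Set.indicator_le_self' (fun _ _ => zero_le) x

theorem familySum_ne_top (hc : ∀ i, c i ≠ ∞) (F : Finset ι) (x : X) : familySum Q c F x ≠ ∞ :=
  (ENNReal.sum_lt_top.2 fun i _ => (indicator_const_le_self _ _ _).trans_lt (hc i).lt_top).ne

theorem familyMax_ne_top (hc : ∀ i, c i ≠ ∞) (F : Finset ι) (x : X) : familyMax Q c F x ≠ ∞ :=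
  ((Finset.sup_lt_iff ENNReal.zero_lt_top).2 fun i _ =>
    (indicator_const_le_self _ _ _).trans_lt (hc i).lt_top).ne

theorem le_familyMax {F : Finset ι} {i : ι} (hi : i ∈ F) {x : X} (hx : x ∈ Q i) :
    c i ≤ familyMax Q c F x := by
  refine le_trans ?_ (Finset.le_sup (f := fun i => (Q i).indicator (fun _ => c i) x) hi)
  simp [hx]

theorem familySum_mono {F G : Finset ι} (h : F ⊆ G) (x : X) :
    familySum Q c F x ≤ familySum Q c G x := Finset.sum_le_sum_of_subset h

open Classical in
theorem familySum_eq_sum_filter (F : Finset ι) (x : X) :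
    familySum Q c F x = ∑ i ∈ F with x ∈ Q i, c i := by
  simp [familySum, Finset.sum_filter, Set.indicator_apply]

/-- A finite sum has finite moments for any measure giving finite mass to the sets. -/
theorem lintegral_familySum_rpow_ne_top [MeasurableSpace X] {μ : Measure X}
    (hQ : ∀ i, MeasurableSet (Q i)) (hc : ∀ i, c i ≠ ∞) (hμ : ∀ i, μ (Q i) ≠ ∞) (F : Finset ι)
    {q : ℝ} (hq : 0 < q) : ∫⁻ x, familySum Q c F x ^ q ∂μ ≠ ∞ := by
  set b : ℝ≥0∞ := ∑ i ∈ F, c i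
  have hb : b ≠ ∞ := (ENNReal.sum_lt_top.2 fun i _ => (hc i).lt_top).ne
  set U : Set X := ⋃ i ∈ F, Q i
  have hU : MeasurableSet U := F.measurableSet_biUnion fun i _ => hQ i
  have hUfin : μ U ≠ ∞ := (measure_biUnion_lt_top F.finite_toSet fun i _ => (hμ i).lt_top).ne
  have hle : ∀ x, familySum Q c F x ^ q ≤ U.indicator (fun _ => b ^ q) x := by
    intro x
    by_cases hx : x ∈ U
    · rw [Set.indicator_of_mem hx]
      exact ENNReal.rpow_le_rpow (Finset.sum_le_sum fun i _ => indicator_const_le_self _ _ _) hq.le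
    · have h0 : familySum Q c F x = 0 := Finset.sum_eq_zero fun i hi =>
        Set.indicator_of_notMem (fun h => hx (Set.mem_biUnion hi h)) _
      simp [h0, hq]
  refine ne_top_of_le_ne_top ?_ (lintegral_mono hle)
  rw [lintegral_indicator_const hU]
  exact ENNReal.mul_ne_top (ENNReal.rpow_ne_top_of_nonneg hq.le hb) hUfin

open Classical in
/-- The part of the sum coming from the sets that contain `P` and have a level strictly above that
of `P`. It is the same at every point of `P`. -/
noncomputable def sumAbove (Q : ι → Set X) (lev : ι → ℤ) (c : ι → ℝ≥0∞) (F : Finset ι)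
    (P : ι) : ℝ≥0∞ :=
  ∑ i ∈ F with lev P < lev i ∧ Q P ⊆ Q i, c i

open Classical in
theorem sumAbove_eq (hN : IsNested Q lev) (F : Finset ι) {P : ι} {x : X} (hx : x ∈ Q P) :
    sumAbove Q lev c F P = ∑ i ∈ F with x ∈ Q i ∧ lev P < lev i, c i := by
  refine Finset.sum_congr (Finset.filter_congr fun i _ => ?_) fun _ _ => rfl
  exact ⟨fun h => ⟨h.2 hx, h.1⟩, fun h => ⟨h.2, (hN P i x hx h.1 h.2.le).1⟩⟩

open Classical in
theorem sumAbove_add (hN : IsNested Q lev) {F : Finset ι} {P : ι} (hP : P ∈ F) {x : X}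
    (hx : x ∈ Q P) :
    sumAbove Q lev c F P + c P = ∑ i ∈ F with x ∈ Q i ∧ lev P ≤ lev i, c i := by
  rw [sumAbove_eq hN F hx, ← Finset.sum_singleton (fun i => c i) P, ← Finset.sum_union]
  · refine Finset.sum_congr ?_ fun _ _ => rfl
    ext i
    simp only [Finset.mem_union, Finset.mem_filter, Finset.mem_singleton]
    constructor
    · rintro (⟨h1, h2, h3⟩ | rfl)
      exacts [⟨h1, h2, h3.le⟩, ⟨hP, hx, le_rfl⟩]
    · rintro ⟨h1, h2, h3⟩
      rcases h3.lt_or_eq with h | h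
      exacts [Or.inl ⟨h1, h2, h⟩, Or.inr ((hN P i x hx h2 h3).2 h).symm]
  · simp

open Classical in
/-- The total at a point of `P` splits into the part above `P` and the part at the level of `P` or
below. -/
theorem familySum_eq_sumAbove_add (hN : IsNested Q lev) (F : Finset ι) {P : ι} {x : X}
    (hx : x ∈ Q P) :
    familySum Q c F x = sumAbove Q lev c F P + familySum Q c {i ∈ F | lev i ≤ lev P} x := by
  rw [familySum_eq_sum_filter, familySum_eq_sum_filter, sumAbove_eq hN F hx,
    ← Finset.sum_filter_add_sum_filter_not {i ∈ F | x ∈ Q i} (fun i => lev P < lev i)]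
  simp only [Finset.filter_filter, not_lt, and_comm]

open Classical in
/-- The stopping sets at height `t`: those where the sum, taken from the top level downwards,
exceeds `t` for the first time. -/
noncomputable def stoppingSets (Q : ι → Set X) (lev : ι → ℤ) (c : ι → ℝ≥0∞) (F : Finset ι)
    (t : ℝ≥0∞) : Finset ι :=
  {P ∈ F | sumAbove Q lev c F P ≤ t ∧ t < sumAbove Q lev c F P + c P}

theorem stoppingSets_pairwiseDisjoint (hN : IsNested Q lev) (F : Finset ι) (t : ℝ≥0∞) :
    (stoppingSets Q lev c F t : Set ι).PairwiseDisjoint Q := by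
  classical
  -- Of two stopping sets that meet, the smaller has the larger one above it.
  have key : ∀ P ∈ stoppingSets Q lev c F t, ∀ P' ∈ stoppingSets Q lev c F t, ∀ x, x ∈ Q P →
      x ∈ Q P' → ¬ lev P < lev P' := by
    intro P hP P' hP' x hx hx' hlt
    simp only [stoppingSets, Finset.mem_filter] at hP hP'
    refine (hP'.2.2.trans_le ?_).not_ge hP.2.1
    rw [sumAbove_add hN hP'.1 hx', sumAbove_eq hN F hx]
    refine Finset.sum_le_sum_of_subset fun i hi => ?_
    simp only [Finset.mem_filter] at hi ⊢
    exact ⟨hi.1, hi.2.1, hlt.trans_le hi.2.2⟩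
  intro P hP P' hP' hne
  refine Set.disjoint_left.2 fun x hx hx' => hne ?_
  have h1 := key P hP P' hP' x hx hx'
  have h2 := key P' hP' P hP x hx' hx
  exact (hN P P' x hx hx' (not_lt.1 h2)).2 (le_antisymm (not_lt.1 h2) (not_lt.1 h1))

theorem exists_stoppingSet (hN : IsNested Q lev) {F : Finset ι} {t : ℝ≥0∞} {x : X}
    (hx : t < familySum Q c F x) : ∃ P ∈ stoppingSets Q lev c F t, x ∈ Q P := by
  classical
  rw [familySum_eq_sum_filter] at hx
  -- The stopping set is the member of highest level at which the sum from above exceeds `t`.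
  set G := {i ∈ F | x ∈ Q i ∧ t < ∑ j ∈ F with x ∈ Q j ∧ lev i ≤ lev j, c j}
  have hne : {i ∈ F | x ∈ Q i}.Nonempty := by
    by_contra h
    rw [Finset.not_nonempty_iff_eq_empty] at h
    simp [h] at hx
  obtain ⟨b, hb, hbmin⟩ := Finset.exists_min_image _ lev hne
  have hG : G.Nonempty := by
    refine ⟨b, ?_⟩
    simp only [Finset.mem_filter, G] at hb ⊢
    refine ⟨hb.1, hb.2, hx.trans_le (Finset.sum_le_sum_of_subset fun i hi => ?_)⟩
    have := hbmin i hi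
    simp only [Finset.mem_filter] at hi ⊢
    exact ⟨hi.1, hi.2, this⟩
  obtain ⟨P, hP, hPmax⟩ := Finset.exists_max_image _ lev hG
  simp only [Finset.mem_filter, G] at hP
  refine ⟨P, ?_, hP.2.1⟩
  simp only [stoppingSets, Finset.mem_filter]
  refine ⟨hP.1, ?_, by rw [sumAbove_add hN hP.1 hP.2.1]; exact hP.2.2⟩
  -- If the part above `P` exceeded `t`, the next member above `P` would also qualify.
  by_contra! hcon
  rw [sumAbove_eq hN F hP.2.1] at hcon
  have hne' : {i ∈ F | x ∈ Q i ∧ lev P < lev i}.Nonempty := by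
    by_contra h
    rw [Finset.not_nonempty_iff_eq_empty] at h
    simp [h] at hcon
  obtain ⟨b', hb', hbmin'⟩ := Finset.exists_min_image _ lev hne'
  have hb2 := Finset.mem_filter.1 hb'
  have hbG : b' ∈ G := by
    simp only [Finset.mem_filter, G]
    refine ⟨hb2.1, hb2.2.1, hcon.trans_le (Finset.sum_le_sum_of_subset fun i hi => ?_)⟩
    have := hbmin' i hi
    simp only [Finset.mem_filter] at hi ⊢
    exact ⟨hi.1, hi.2.1, this⟩
  exact (hPmax b' hbG).not_gt hb2.2.2

open Classical in
/-- **Good-λ inequality** for a nested family. If on each set `P` with `c P ≤ κ t` the part of the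
sum living at or below the level of `P` exceeds `t` only on an `ε`-fraction of `P`, then the sum
exceeds `(1 + s) t` on at most an `ε`-fraction of where it exceeds `t`, apart from the set where
the maximal operator exceeds `κ s t`. -/
theorem IsNested.goodLambda [MeasurableSpace X] {μ : Measure X} (hN : IsNested Q lev)
    (hQ : ∀ i, MeasurableSet (Q i)) (F : Finset ι) {ε : ℝ≥0∞} {κ : ℝ}
    (hdecay : ∀ P ∈ F, ∀ t : ℝ, 0 < t → c P ≤ ENNReal.ofReal (κ * t) →
      μ (Q P ∩ {x | ENNReal.ofReal t < familySum Q c {i ∈ F | lev i ≤ lev P} x}) ≤ ε * μ (Q P))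
    {s : ℝ} (hs : 0 < s) {t : ℝ} (ht : 0 < t) :
    μ {x | ENNReal.ofReal ((1 + s) * t) < familySum Q c F x} ≤
      ε * μ {x | ENNReal.ofReal t < familySum Q c F x} +
        μ {x | ENNReal.ofReal (κ * s * t) < familyMax Q c F x} := by
  set S := stoppingSets Q lev c F (ENNReal.ofReal t)
  set A : ι → Set X := fun P => {x | x ∈ Q P ∧ ENNReal.ofReal ((1 + s) * t) < familySum Q c F x ∧
    familyMax Q c F x ≤ ENNReal.ofReal (κ * s * t)}
  have hA : ∀ P ∈ S, μ (A P) ≤ ε * μ (Q P) := by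
    intro P hP
    simp only [S, stoppingSets, Finset.mem_filter] at hP
    rcases (A P).eq_empty_or_nonempty with h | ⟨x₀, hx₀⟩
    · simp [h]
    have hcP : c P ≤ ENNReal.ofReal (κ * (s * t)) := by
      rw [← mul_assoc]; exact (le_familyMax hP.1 hx₀.1).trans hx₀.2.2
    refine (measure_mono ?_).trans (hdecay P hP.1 (s * t) (by positivity) hcP)
    refine fun x hx => ⟨hx.1, ?_⟩
    by_contra! hcon
    refine hx.2.1.not_ge ?_
    rw [familySum_eq_sumAbove_add hN F hx.1, add_mul, one_mul,
      ENNReal.ofReal_add ht.le (by positivity)]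
    exact add_le_add hP.2.1 (not_lt.1 hcon)
  have hcover : {x | ENNReal.ofReal ((1 + s) * t) < familySum Q c F x} ⊆
      (⋃ P ∈ S, A P) ∪ {x | ENNReal.ofReal (κ * s * t) < familyMax Q c F x} := by
    intro x hx
    rcases lt_or_ge (ENNReal.ofReal (κ * s * t)) (familyMax Q c F x) with h | h
    · exact Or.inr h
    · have hx' : ENNReal.ofReal t < familySum Q c F x := by
        refine lt_of_le_of_lt (ENNReal.ofReal_le_ofReal ?_) hx
        nlinarith [mul_pos hs ht]
      obtain ⟨P, hP, hxP⟩ := exists_stoppingSet hN hx'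
      exact Or.inl (Set.mem_biUnion hP ⟨hxP, hx, h⟩)
  calc _ ≤ μ (⋃ P ∈ S, A P) + _ := (measure_mono hcover).trans (measure_union_le _ _)
    _ ≤ (∑ P ∈ S, μ (A P)) + _ := by gcongr; exact measure_biUnion_finset_le _ _
    _ ≤ (∑ P ∈ S, ε * μ (Q P)) + _ := by gcongr with P hP; exact hA P hP
    _ = ε * μ (⋃ P ∈ S, Q P) + _ := by
        rw [← Finset.mul_sum, measure_biUnion_finset (stoppingSets_pairwiseDisjoint hN F _)
          fun i _ => hQ i]
    _ ≤ _ := by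
        gcongr
        refine Set.iUnion₂_subset fun P hP x hx => ?_
        simp only [S, stoppingSets, Finset.mem_filter] at hP
        refine hP.2.2.trans_le ?_
        rw [sumAbove_add hN hP.1 hx, familySum_eq_sum_filter]
        refine Finset.sum_le_sum_of_subset fun i hi => ?_
        simp only [Finset.mem_filter] at hi ⊢
        exact ⟨hi.1, hi.2.1⟩

end

/-! ### Axis-parallel cubes and dyadic cubes -/

theorem axisCube_eq_preimage {n : ℕ} (a : EuclideanSpace ℝ (Fin n)) (l : ℝ) :
    axisCube a l = (MeasurableEquiv.toLp 2 (Fin n → ℝ)).symm ⁻¹'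
      Set.Icc (fun j => a j) (fun j => a j + l) := by
  ext x
  simp [axisCube, Pi.le_def, forall_and]

theorem measurableSet_axisCube {n : ℕ} (a : EuclideanSpace ℝ (Fin n)) (l : ℝ) :
    MeasurableSet (axisCube a l) := by
  rw [axisCube_eq_preimage]
  exact (MeasurableEquiv.measurable _) measurableSet_Icc

theorem volume_axisCube {n : ℕ} (a : EuclideanSpace ℝ (Fin n)) (l : ℝ) :
    volume (axisCube a l) = ENNReal.ofReal l ^ n := by
  rw [axisCube_eq_preimage,
    (EuclideanSpace.volume_preserving_symm_measurableEquiv_toLp (Fin n)).measure_preimage_equiv,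
    Real.volume_Icc_pi]
  simp

theorem isCompact_axisCube {n : ℕ} (a : EuclideanSpace ℝ (Fin n)) (l : ℝ) :
    IsCompact (axisCube a l) := by
  have : axisCube a l = WithLp.toLp 2 '' Set.Icc (fun j => a j) (fun j => a j + l) := by
    ext x
    refine ⟨fun h => ⟨fun j => x j, ⟨fun j => (h j).1, fun j => (h j).2⟩, rfl⟩, ?_⟩
    rintro ⟨y, hy, rfl⟩ j
    exact ⟨hy.1 j, hy.2 j⟩
  rw [this]
  exact isCompact_Icc.image (PiLp.continuous_toLp 2 _)

/-- The closed axis-parallel cube with centre `x` and side `2 r`. -/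
noncomputable def centredCube {n : ℕ} (x : EuclideanSpace ℝ (Fin n)) (r : ℝ) :
    Set (EuclideanSpace ℝ (Fin n)) :=
  axisCube (WithLp.toLp 2 fun j => x j - r) (2 * r)

theorem mem_centredCube {n : ℕ} {x u : EuclideanSpace ℝ (Fin n)} {r : ℝ} :
    u ∈ centredCube x r ↔ ∀ j, |u j - x j| ≤ r := by
  simp only [centredCube, axisCube, Set.mem_ofPred_eq, abs_le]
  exact forall_congr' fun j => ⟨fun h => ⟨by linarith [h.1], by linarith [h.2]⟩,
    fun h => ⟨by linarith [h.1], by linarith [h.2]⟩⟩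

/-- The half-open dyadic cube `∏ j, [2 ^ k z_j, 2 ^ k (z_j + 1))` with index `(k, z)`. -/
def dyadicCube {n : ℕ} (i : ℤ × (Fin n → ℤ)) : Set (EuclideanSpace ℝ (Fin n)) :=
  {x | ∀ j, ⌊x j / (2 : ℝ) ^ i.1⌋ = i.2 j}

/-- The closed cube with the centre of the dyadic cube of index `i` and three times its side. -/
noncomputable def tripleCube {n : ℕ} (i : ℤ × (Fin n → ℤ)) : Set (EuclideanSpace ℝ (Fin n)) :=
  axisCube (WithLp.toLp 2 fun j => (2 : ℝ) ^ i.1 * (i.2 j - 1)) (3 * (2 : ℝ) ^ i.1)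

theorem mem_dyadicCube {n : ℕ} {i : ℤ × (Fin n → ℤ)} {x : EuclideanSpace ℝ (Fin n)} :
    x ∈ dyadicCube i ↔
      ∀ j, (2 : ℝ) ^ i.1 * i.2 j ≤ x j ∧ x j < (2 : ℝ) ^ i.1 * i.2 j + (2 : ℝ) ^ i.1 := by
  have h2 : (0 : ℝ) < 2 ^ i.1 := by positivity
  refine forall_congr' fun j => ?_
  rw [Int.floor_eq_iff, le_div_iff₀ h2, div_lt_iff₀ h2, add_mul, one_mul, mul_comm]

theorem dyadicCube_eq_preimage {n : ℕ} (i : ℤ × (Fin n → ℤ)) :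
    dyadicCube i = (MeasurableEquiv.toLp 2 (Fin n → ℝ)).symm ⁻¹'
      Set.univ.pi (fun j => Set.Ico ((2 : ℝ) ^ i.1 * i.2 j)
        ((2 : ℝ) ^ i.1 * i.2 j + (2 : ℝ) ^ i.1)) := by
  ext x
  simp [mem_dyadicCube]

theorem measurableSet_dyadicCube {n : ℕ} (i : ℤ × (Fin n → ℤ)) : MeasurableSet (dyadicCube i) := by
  rw [dyadicCube_eq_preimage]
  exact (MeasurableEquiv.measurable _) (MeasurableSet.univ_pi fun _ => measurableSet_Ico)

theorem dyadicCube_subset_axisCube {n : ℕ} (i : ℤ × (Fin n → ℤ)) :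
    dyadicCube i ⊆ axisCube (WithLp.toLp 2 fun j => (2 : ℝ) ^ i.1 * i.2 j) ((2 : ℝ) ^ i.1) :=
  fun _ hx j => ⟨(mem_dyadicCube.1 hx j).1, (mem_dyadicCube.1 hx j).2.le⟩

theorem dyadicCube_ae_eq_axisCube {n : ℕ} (i : ℤ × (Fin n → ℤ)) :
    dyadicCube i =ᵐ[volume]
      axisCube (WithLp.toLp 2 fun j => (2 : ℝ) ^ i.1 * i.2 j) ((2 : ℝ) ^ i.1) := by
  rw [dyadicCube_eq_preimage, axisCube_eq_preimage]
  refine (EuclideanSpace.volume_preserving_symm_measurableEquiv_toLp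
    (Fin n)).quasiMeasurePreserving.preimage_ae_eq ?_
  exact Measure.univ_pi_Ico_ae_eq_Icc

theorem volume_dyadicCube {n : ℕ} (i : ℤ × (Fin n → ℤ)) :
    volume (dyadicCube i) = ENNReal.ofReal ((2 : ℝ) ^ i.1) ^ n := by
  rw [measure_congr (dyadicCube_ae_eq_axisCube i), volume_axisCube]

/-- Dyadic cubes are nested, because the integer part at a coarser scale is determined by the
integer part at a finer one. -/
theorem isNested_dyadicCube {n : ℕ} :
    IsNested (dyadicCube (n := n)) (Prod.fst : ℤ × (Fin n → ℤ) → ℤ) := by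
  intro i i' x hx hx' hle
  have floor_eq : ∀ y : ℝ, ⌊y / (2 : ℝ) ^ i'.1⌋ =
      ⌊y / (2 : ℝ) ^ i.1⌋ / ((2 ^ (i'.1 - i.1).toNat : ℕ) : ℤ) := by
    intro y
    rw [← Int.floor_div_natCast, div_div]
    congr 2
    have : ((i'.1 - i.1).toNat : ℤ) = i'.1 - i.1 := Int.toNat_of_nonneg (by omega)
    push_cast
    rw [← zpow_natCast, this, ← zpow_add₀ two_ne_zero]
    congr 1; ring
  refine ⟨fun y hy j => ?_, fun heq => ?_⟩
  · rw [← hx' j, floor_eq, floor_eq, hy j, hx j]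
  · refine Prod.ext heq (funext fun j => ?_)
    rw [← hx j, ← hx' j, heq]

theorem dyadicCube_subset_tripleCube {n : ℕ} (i : ℤ × (Fin n → ℤ)) :
    dyadicCube i ⊆ tripleCube i := by
  intro x hx j
  have h2 : (0 : ℝ) < 2 ^ i.1 := by positivity
  have := mem_dyadicCube.1 hx j
  simp only
  constructor <;> linarith

theorem centredCube_subset_tripleCube {n : ℕ} {i : ℤ × (Fin n → ℤ)}
    {x : EuclideanSpace ℝ (Fin n)} (hx : x ∈ dyadicCube i) :
    centredCube x ((2 : ℝ) ^ i.1) ⊆ tripleCube i := by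
  intro u hu j
  have := mem_dyadicCube.1 hx j
  have := abs_le.1 (mem_centredCube.1 hu j)
  simp only
  constructor <;> linarith

theorem tripleCube_subset_centredCube {n : ℕ} {i : ℤ × (Fin n → ℤ)}
    {x : EuclideanSpace ℝ (Fin n)} (hx : x ∈ dyadicCube i) :
    tripleCube i ⊆ centredCube x (2 * (2 : ℝ) ^ i.1) := by
  intro u hu
  refine mem_centredCube.2 fun j => ?_
  have := mem_dyadicCube.1 hx j
  have := hu j
  simp only at this
  rw [abs_le]
  constructor <;> linarith

theorem toLp_mem_dyadicCube {n : ℕ} (i : ℤ × (Fin n → ℤ)) {s : ℝ} (hs : 0 ≤ s)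
    (hs' : s < (2 : ℝ) ^ i.1) :
    WithLp.toLp 2 (fun j => (2 : ℝ) ^ i.1 * i.2 j + s) ∈ dyadicCube i :=
  mem_dyadicCube.2 fun j => ⟨by simp [hs], by simp [hs']⟩

theorem tripleCube_mono {n : ℕ} {i i' : ℤ × (Fin n → ℤ)} (h : dyadicCube i ⊆ dyadicCube i')
    (hle : i.1 ≤ i'.1) : tripleCube i ⊆ tripleCube i' := by
  intro u hu j
  have hpow : (2 : ℝ) ^ i.1 ≤ 2 ^ i'.1 := zpow_le_zpow_right₀ one_le_two hle
  have h2 : (0 : ℝ) < 2 ^ i.1 := by positivity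
  have huj := hu j
  simp only at huj ⊢
  -- The lower corner of the smaller cube lies in the larger one, and so do points near its
  -- upper corner.
  have hlow := mem_dyadicCube.1 (h (toLp_mem_dyadicCube i le_rfl h2)) j
  have hup : (2 : ℝ) ^ i.1 * i.2 j + 2 ^ i.1 ≤ (2 : ℝ) ^ i'.1 * i'.2 j + 2 ^ i'.1 := by
    refine le_of_forall_pos_le_add fun ε hε => ?_
    set δ := min ε (2 ^ i.1)
    have hδ : 0 < δ := lt_min hε h2
    have hδ' : δ ≤ 2 ^ i.1 := min_le_right _ _
    have := mem_dyadicCube.1 (h (toLp_mem_dyadicCube i (s := 2 ^ i.1 - δ)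
      (by linarith) (by linarith))) j
    simp only at this
    linarith [min_le_left ε ((2 : ℝ) ^ i.1)]
  simp only at hlow
  constructor <;> linarith

theorem exists_mem_dyadicCube {n : ℕ} (k : ℤ) (x : EuclideanSpace ℝ (Fin n)) :
    x ∈ dyadicCube (k, fun j => ⌊x j / (2 : ℝ) ^ k⌋) := fun _ => rfl

/-! ### Muckenhoupt weights -/

/-- Hölder's inequality for `1 = w ^ (1 / p) * w ^ (-1 / p)`. -/
theorem measure_rpow_le_lintegral_mul_lintegral {X : Type*} [MeasurableSpace X] {μ : Measure X}
    {w : X → ℝ≥0∞} (hw : AEMeasurable w μ) (hw0 : ∀ᵐ x ∂μ, w x ≠ 0) (hw1 : ∀ᵐ x ∂μ, w x ≠ ∞)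
    {p : ℝ} (hp : 1 < p) :
    μ Set.univ ^ p ≤ (∫⁻ x, w x ∂μ) * (∫⁻ x, w x ^ (-1 / (p - 1)) ∂μ) ^ (p - 1) := by
  have hp0 : 0 < p := by linarith
  have hp1 : 0 < p - 1 := by linarith
  have hpq : p.HolderConjugate (p / (p - 1)) := Real.HolderConjugate.conjExponent hp
  have hol := ENNReal.lintegral_mul_le_Lp_mul_Lq μ hpq (hw.pow_const (1 / p))
    (hw.pow_const (-1 / p))
  have h1 : ∫⁻ x, ((fun x => w x ^ (1 / p)) * fun x => w x ^ (-1 / p)) x ∂μ = μ Set.univ := by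
    rw [← lintegral_one]
    refine lintegral_congr_ae ?_
    filter_upwards [hw0, hw1] with x h0 h1
    simp only [Pi.mul_apply]
    rw [← ENNReal.rpow_add _ _ h0 h1]
    have : 1 / p + -1 / p = 0 := by ring
    rw [this, ENNReal.rpow_zero]
  rw [h1] at hol
  simp only [← ENNReal.rpow_mul] at hol
  have e1 : 1 / p * p = 1 := by field_simp
  have e2 : -1 / p * (p / (p - 1)) = -1 / (p - 1) := by field_simp
  have e3 : 1 / (p / (p - 1)) * p = p - 1 := by field_simp
  simp only [e1, e2, ENNReal.rpow_one] at hol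
  calc μ Set.univ ^ p ≤ _ := ENNReal.rpow_le_rpow hol hp0.le
    _ = _ := by
      rw [ENNReal.mul_rpow_of_nonneg _ _ hp0.le, ← ENNReal.rpow_mul, ← ENNReal.rpow_mul, e1, e3,
        ENNReal.rpow_one]

section
variable {n : ℕ} {ω : EuclideanSpace ℝ (Fin n) → ℝ}

theorem weightMeasure_axisCube_ne_top (hω : LocallyIntegrable ω volume)
    (a : EuclideanSpace ℝ (Fin n)) (l : ℝ) : weightMeasure ω (axisCube a l) ≠ ∞ := by
  rw [weightMeasure, withDensity_apply _ (measurableSet_axisCube a l)]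
  exact ((hω.integrableOn_isCompact (isCompact_axisCube a l)).lintegral_lt_top).ne

/-- The `A_p` condition compares the weight of a cube with the weight of its subsets. -/
theorem IsApWeight.measure_rpow_mul_le {p : ℝ} (hp : 1 < p) (hω : IsApWeight p ω) :
    ∃ K : ℝ≥0∞, K < ∞ ∧ ∀ (a : EuclideanSpace ℝ (Fin n)) (l : ℝ), 0 < l →
      ∀ F ⊆ axisCube a l, MeasurableSet F →
        volume F ^ p * weightMeasure ω (axisCube a l) ≤
          K * volume (axisCube a l) ^ p * weightMeasure ω F := by
  obtain ⟨K, hK, hbound⟩ := hω.bound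
  refine ⟨K, hK, fun a l hl F hF hFm => ?_⟩
  have hp0 : 0 < p := by linarith
  have hp1 : 0 < p - 1 := by linarith
  have hb := hbound a l hl
  set Q := axisCube a l
  have hQm : MeasurableSet Q := measurableSet_axisCube a l
  set w : EuclideanSpace ℝ (Fin n) → ℝ≥0∞ := fun x => ENNReal.ofReal (ω x)
  have hw : AEMeasurable w volume :=
    hω.locallyIntegrable.aestronglyMeasurable.aemeasurable.ennreal_ofReal
  have hV0 : volume Q ≠ 0 := by rw [volume_axisCube]; simp [hl]
  have hV1 : volume Q ≠ ∞ := by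
    rw [volume_axisCube]; exact ENNReal.pow_ne_top ENNReal.ofReal_ne_top
  rw [weightMeasure, withDensity_apply _ hQm, withDensity_apply _ hFm]
  change _ * (∫⁻ x in Q, w x) ≤ _ * ∫⁻ x in F, w x
  set A := ∫⁻ x in Q, w x
  set S := ∫⁻ x in Q, w x ^ (-1 / (p - 1))
  set V := volume Q
  change A / V * (S / V) ^ (p - 1) ≤ K at hb
  -- A weight of mass zero on `Q` is harmless; otherwise the bound keeps `w` from vanishing on a
  -- subset of positive measure.
  rcases eq_or_ne A 0 with hA | hA
  · simp [hA]
  have hS : S ≠ ∞ := by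
    intro hS
    rw [hS, ENNReal.top_div_of_ne_top hV1, ENNReal.top_rpow_of_pos hp1,
      ENNReal.mul_top (ENNReal.div_ne_zero.2 ⟨hA, hV1⟩)] at hb
    exact hK.not_ge hb
  have hAS : A * S ^ (p - 1) ≤ K * V ^ p := by
    have e : V ^ p = V * V ^ (p - 1) := by
      nth_rw 2 [← ENNReal.rpow_one V]
      rw [← ENNReal.rpow_add _ _ hV0 hV1]; congr 1; ring
    have hVp0 : V ^ (p - 1) ≠ 0 := by simp [hV0, hV1]
    have hVp1 : V ^ (p - 1) ≠ ∞ := ENNReal.rpow_ne_top_of_nonneg hp1.le hV1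
    calc A * S ^ (p - 1) = (A / V * V) * ((S / V) ^ (p - 1) * V ^ (p - 1)) := by
          rw [ENNReal.div_mul_cancel hV0 hV1, ENNReal.div_rpow_of_nonneg _ _ hp1.le,
            ENNReal.div_mul_cancel hVp0 hVp1]
      _ = (A / V * (S / V) ^ (p - 1)) * V ^ p := by rw [e]; ring
      _ ≤ _ := by gcongr
  have hw0 : ∀ᵐ x ∂volume.restrict F, w x ≠ 0 := by
    have := ae_lt_top' (hw.restrict.pow_const _) hS
    refine (ae_restrict_of_ae_restrict_of_subset hF this).mono fun x hx h0 => ?_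
    rw [h0, ENNReal.zero_rpow_of_neg (div_neg_of_neg_of_pos (by norm_num) hp1)] at hx
    exact lt_irrefl _ hx
  have hol := measure_rpow_le_lintegral_mul_lintegral (hw.restrict (s := F)) hw0
    (ae_of_all _ fun x => ENNReal.ofReal_ne_top) hp
  rw [Measure.restrict_apply_univ] at hol
  calc volume F ^ p * A
      ≤ ((∫⁻ x in F, w x) * (∫⁻ x in F, w x ^ (-1 / (p - 1))) ^ (p - 1)) * A := by gcongr
    _ ≤ ((∫⁻ x in F, w x) * S ^ (p - 1)) * A := by
        gcongr
        exact lintegral_mono_set hF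
    _ = (A * S ^ (p - 1)) * ∫⁻ x in F, w x := by ring
    _ ≤ _ := by gcongr

/-- For an `A_∞` weight, a subset of at most half the volume of a cube misses a fixed fraction of
its weight. -/
theorem IsAInftyWeight.exists_measure_le (hω : IsAInftyWeight ω) :
    ∃ θ : ℝ, 0 < θ ∧ θ ≤ 1 / 2 ∧ ∀ (a : EuclideanSpace ℝ (Fin n)) (l : ℝ), 0 < l →
      ∀ E ⊆ axisCube a l, MeasurableSet E → volume E ≤ volume (axisCube a l) / 2 →
        weightMeasure ω E ≤ ENNReal.ofReal (1 - θ) * weightMeasure ω (axisCube a l) := by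
  obtain ⟨p, hp, hω⟩ := hω
  obtain ⟨K, hK, h⟩ := hω.measure_rpow_mul_le hp
  have hp0 : 0 < p := by linarith
  -- The half outside `E` carries at least `1 / (2 ^ p K)` of the weight; the summand `2` only
  -- serves to keep `1 / B` at most `1 / 2`.
  set B : ℝ := 2 ^ p * K.toReal + 2
  have hB : 2 ≤ B := le_add_of_nonneg_left (by positivity)
  have hB0 : 0 < B := by linarith
  refine ⟨1 / B, by positivity, one_div_le_one_div_of_le two_pos hB,
    fun a l hl E hE hEm hvol => ?_⟩
  have hF := h a l hl (axisCube a l \ E) Set.sdiff_subset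
    ((measurableSet_axisCube a l).diff hEm)
  have hfin := weightMeasure_axisCube_ne_top hω.locallyIntegrable a l
  have hV0 : volume (axisCube a l) ≠ 0 := by rw [volume_axisCube]; simp [hl]
  have hV1 : volume (axisCube a l) ≠ ∞ := by
    rw [volume_axisCube]; exact ENNReal.pow_ne_top ENNReal.ofReal_ne_top
  have hsplit := measure_inter_add_sdiff (μ := weightMeasure ω) (axisCube a l) hEm
  have hsplit' := measure_inter_add_sdiff (μ := volume) (axisCube a l) hEm
  rw [Set.inter_eq_right.2 hE] at hsplit hsplit'
  set Q := axisCube a l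
  have hhalf : volume Q / 2 ≤ volume (Q \ E) := by
    have h2 : volume Q / 2 ≠ ∞ := (ENNReal.div_lt_top hV1 two_ne_zero).ne
    rw [← ENNReal.add_le_add_iff_left h2, ENNReal.add_halves]
    calc volume Q = volume E + volume (Q \ E) := hsplit'.symm
      _ ≤ _ := by gcongr
  have hVp0 : volume Q ^ p ≠ 0 := by simp [hV0, hV1]
  have hVp1 : volume Q ^ p ≠ ∞ := ENNReal.rpow_ne_top_of_nonneg hp0.le hV1
  have h2p0 : (2 : ℝ≥0∞) ^ p ≠ 0 := by simp
  have h2p1 : (2 : ℝ≥0∞) ^ p ≠ ∞ := ENNReal.rpow_ne_top_of_nonneg hp0.le ENNReal.ofNat_ne_top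
  have key : weightMeasure ω Q ≤ 2 ^ p * K * weightMeasure ω (Q \ E) := by
    have h1 : (volume Q / 2) ^ p * weightMeasure ω Q ≤
        K * volume Q ^ p * weightMeasure ω (Q \ E) := le_trans (by gcongr) hF
    rw [ENNReal.div_rpow_of_nonneg _ _ hp0.le] at h1
    rw [← ENNReal.mul_le_mul_iff_right hVp0 hVp1]
    calc volume Q ^ p * weightMeasure ω Q
        = 2 ^ p * (volume Q ^ p / 2 ^ p * weightMeasure ω Q) := by
          rw [← mul_assoc, ENNReal.mul_div_cancel h2p0 h2p1]
      _ ≤ 2 ^ p * (K * volume Q ^ p * weightMeasure ω (Q \ E)) := by gcongr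
      _ = _ := by ring
  have hKB : 2 ^ p * K ≤ ENNReal.ofReal B := by
    rw [ENNReal.ofReal_add (by positivity) zero_le_two, ENNReal.ofReal_mul (by positivity),
      ENNReal.ofReal_toReal hK.ne, ← ENNReal.ofReal_rpow_of_pos two_pos]
    simp
  have key2 : ENNReal.ofReal (1 / B) * weightMeasure ω Q ≤ weightMeasure ω (Q \ E) := by
    calc ENNReal.ofReal (1 / B) * weightMeasure ω Q
        ≤ ENNReal.ofReal (1 / B) * (ENNReal.ofReal B * weightMeasure ω (Q \ E)) := by
          gcongr
          exact key.trans (by gcongr)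
      _ = _ := by
          rw [← mul_assoc, ← ENNReal.ofReal_mul (by positivity), one_div_mul_cancel hB0.ne']
          simp
  have hc : ENNReal.ofReal (1 / B) * weightMeasure ω Q ≠ ∞ :=
    ENNReal.mul_ne_top ENNReal.ofReal_ne_top hfin
  rw [← ENNReal.add_le_add_iff_right hc, ← add_mul, ← ENNReal.ofReal_add _ (by positivity)]
  · calc _ ≤ weightMeasure ω E + weightMeasure ω (Q \ E) := by gcongr
      _ = _ := by rw [hsplit]; simp
  · rw [sub_nonneg, div_le_one hB0]; linarith

end

/-! ### The local estimate for the dyadic model operator -/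

theorem measurableSet_mem_centredCube {n : ℕ} (r : ℝ) {R : Set (EuclideanSpace ℝ (Fin n))}
    (hR : MeasurableSet R) :
    MeasurableSet {z : EuclideanSpace ℝ (Fin n) × EuclideanSpace ℝ (Fin n) |
      z.2 ∈ centredCube z.1 r ∩ R} := by
  have h : {z : EuclideanSpace ℝ (Fin n) × EuclideanSpace ℝ (Fin n) | z.2 ∈ centredCube z.1 r} =
      ⋂ j, {z | |z.2 j - z.1 j| ≤ r} := by
    ext z; simp [mem_centredCube]
  have h' : MeasurableSet {z : EuclideanSpace ℝ (Fin n) × EuclideanSpace ℝ (Fin n) |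
      z.2 ∈ centredCube z.1 r} := by
    rw [h]
    exact MeasurableSet.iInter fun j => measurableSet_le (by fun_prop) measurable_const
  exact h'.inter (measurable_snd hR)

theorem measurable_measure_centredCube_inter {n : ℕ} (ν : Measure (EuclideanSpace ℝ (Fin n)))
    [SFinite ν] (r : ℝ) {R : Set (EuclideanSpace ℝ (Fin n))} (hR : MeasurableSet R) :
    Measurable fun x => ν (centredCube x r ∩ R) :=
  measurable_measure_prodMk_left (measurableSet_mem_centredCube r hR)

/-- The `ν`-measure of the cube of fixed size centred at `x` integrates in `x` to the volume of the
cube times the mass of `ν`, by Tonelli's theorem. -/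
theorem lintegral_measure_centredCube_inter_le {n : ℕ} (ν : Measure (EuclideanSpace ℝ (Fin n)))
    [SFinite ν] (r : ℝ) {R : Set (EuclideanSpace ℝ (Fin n))} (hR : MeasurableSet R) :
    ∫⁻ x, ν (centredCube x r ∩ R) ≤ ENNReal.ofReal (2 * r) ^ n * ν R := by
  have hs := measurableSet_mem_centredCube r hR
  have h1 : ∫⁻ x, ν (centredCube x r ∩ R) = (volume.prod ν) _ := (Measure.prod_apply hs).symm
  rw [h1, Measure.prod_apply_symm hs, ← lintegral_indicator_const hR]
  refine lintegral_mono fun u => ?_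
  by_cases hu : u ∈ R
  · rw [Set.indicator_of_mem hu, ← volume_axisCube (WithLp.toLp 2 fun j => u j - r)]
    refine measure_mono fun x hx => ?_
    exact mem_centredCube.2 fun j => by rw [abs_sub_comm]; exact mem_centredCube.1 hx.1 j
  · rw [Set.indicator_of_notMem hu, nonpos_iff_eq_zero]
    convert! measure_empty (μ := volume)
    ext x
    simp [hu]

theorem ENNReal.ofReal_two_zpow (k : ℤ) :
    ENNReal.ofReal ((2 : ℝ) ^ k) = (2 : ℝ≥0∞) ^ (k : ℝ) := by
  rw [← Real.rpow_intCast, ← ENNReal.ofReal_rpow_of_pos two_pos]; simp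

theorem ENNReal.two_rpow_add (a b : ℝ) : (2 : ℝ≥0∞) ^ (a + b) = 2 ^ a * 2 ^ b :=
  ENNReal.rpow_add _ _ two_ne_zero ENNReal.ofNat_ne_top

theorem ENNReal.sum_rpow_le {ι : Type*} (s : Finset ι) (g : ι → ℝ≥0∞) {r : ℝ} (hr : 0 < r)
    (hr1 : r ≤ 1) : (∑ i ∈ s, g i) ^ r ≤ ∑ i ∈ s, g i ^ r :=
  Finset.le_sum_of_subadditive (fun x : ℝ≥0∞ => x ^ r) (by simp [hr])
    (fun x y => ENNReal.rpow_add_le_add_rpow x y hr.le hr1) s g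

/-- The coefficient `2 ^ (-k β) ∏ l, ν l (3Q)` of the dyadic model operator, for the dyadic cube
`Q` of side `2 ^ k` with index `i`. -/
noncomputable def dyadicCoeff {m n : ℕ} (β : ℝ) (ν : Fin m → Measure (EuclideanSpace ℝ (Fin n)))
    (i : ℤ × (Fin n → ℤ)) : ℝ≥0∞ :=
  (2 : ℝ≥0∞) ^ (-((i.1 : ℝ) * β)) * ∏ l, ν l (tripleCube i)

section
variable {m n : ℕ} {β : ℝ} {ν : Fin m → Measure (EuclideanSpace ℝ (Fin n))}

theorem dyadicCoeff_ne_top (hν : ∀ l i, ν l (tripleCube i) ≠ ∞) (i : ℤ × (Fin n → ℤ)) :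
    dyadicCoeff β ν i ≠ ∞ :=
  ENNReal.mul_ne_top (by simp [ENNReal.rpow_eq_top_iff]) (ENNReal.prod_ne_top fun l _ => hν l i)

/-- A majorant at `x ∈ P` of the `m`-th root of the coefficient of the dyadic cube that contains `x`
and lies `j` generations below `P`. The triple of that cube is replaced by a cube centred at `x`, so
that the dependence on `x` can be integrated by Tonelli's theorem. -/
noncomputable def generationMajorant (β : ℝ) (ν : Fin m → Measure (EuclideanSpace ℝ (Fin n)))
    (P : ℤ × (Fin n → ℤ)) (j : ℕ) (x : EuclideanSpace ℝ (Fin n)) : ℝ≥0∞ :=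
  (2 : ℝ≥0∞) ^ (-(((P.1 - j : ℤ) : ℝ) * β) * (1 / (m : ℝ))) *
    ∏ l, ν l (centredCube x (2 * (2 : ℝ) ^ (P.1 - j : ℤ)) ∩ tripleCube P) ^ (1 / (m : ℝ))

theorem measurable_generationMajorant [∀ l, SFinite (ν l)] (P : ℤ × (Fin n → ℤ)) (j : ℕ) :
    Measurable (generationMajorant β ν P j) :=
  (Finset.measurable_prod _ fun l _ => (measurable_measure_centredCube_inter (ν l) _
    (measurableSet_axisCube _ _)).pow_const _).const_mul _

open Classical in
theorem familySum_rpow_le_tsum_generationMajorant (hm : 0 < m) (F : Finset (ℤ × (Fin n → ℤ)))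
    {P : ℤ × (Fin n → ℤ)} {x : EuclideanSpace ℝ (Fin n)} (hx : x ∈ dyadicCube P) :
    familySum dyadicCube (dyadicCoeff β ν) {i ∈ F | i.1 ≤ P.1} x ^ (1 / (m : ℝ)) ≤
      ∑' j, generationMajorant β ν P j x := by
  have hm0 : (0 : ℝ) < m := by exact_mod_cast hm
  have hm1 : 1 / (m : ℝ) ≤ 1 := by
    rw [div_le_one hm0]; exact_mod_cast hm
  rw [familySum_eq_sum_filter]
  set S := {i ∈ {i ∈ F | i.1 ≤ P.1} | x ∈ dyadicCube i}
  have hS : ∀ i ∈ S, i.1 ≤ P.1 ∧ x ∈ dyadicCube i := fun i hi => by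
    simp only [S, Finset.mem_filter] at hi
    exact ⟨hi.1.2, hi.2⟩
  set φ : ℤ × (Fin n → ℤ) → ℕ := fun i => (P.1 - i.1).toNat
  have hφ : ∀ i ∈ S, P.1 - (φ i : ℤ) = i.1 := fun i hi => by
    have := (hS i hi).1
    simp only [φ]; omega
  have hinj : Set.InjOn φ S := by
    intro i hi i' hi' h
    have e : i.1 = i'.1 := by rw [← hφ i hi, ← hφ i' hi', h]
    exact (isNested_dyadicCube i i' x (hS i hi).2 (hS i' hi').2 e.le).2 e
  calc _ ≤ ∑ i ∈ S, dyadicCoeff β ν i ^ (1 / (m : ℝ)) :=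
        ENNReal.sum_rpow_le _ _ (by positivity) hm1
    _ ≤ ∑ i ∈ S, generationMajorant β ν P (φ i) x := by
        refine Finset.sum_le_sum fun i hi => ?_
        rw [dyadicCoeff, generationMajorant, hφ i hi,
          ENNReal.mul_rpow_of_nonneg _ _ (by positivity), ← ENNReal.rpow_mul,
          ← ENNReal.prod_rpow_of_nonneg (by positivity)]
        gcongr with l
        exact Set.subset_inter (tripleCube_subset_centredCube (hS i hi).2)
          (tripleCube_mono (isNested_dyadicCube i P x (hS i hi).2 hx (hS i hi).1).1 (hS i hi).1)
    _ = ∑ j ∈ S.image φ, generationMajorant β ν P j x :=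
        (Finset.sum_image (f := fun j => generationMajorant β ν P j x) hinj).symm
    _ ≤ _ := ENNReal.sum_le_tsum _

/-- The contribution of the `j`-th generation decays geometrically in `j`. The product of `m`-th
roots is integrated by Hölder's inequality. -/
theorem lintegral_generationMajorant_le [∀ l, SFinite (ν l)] (hm : 0 < m) (P : ℤ × (Fin n → ℤ))
    (j : ℕ) :
    ∫⁻ x, generationMajorant β ν P j x ≤
      4 ^ n * ((2 : ℝ≥0∞) ^ (-(n - β / m))) ^ j *
        (volume (dyadicCube P) * dyadicCoeff β ν P ^ (1 / (m : ℝ))) := by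
  have hm0 : (0 : ℝ) < m := by exact_mod_cast hm
  have hmi : 0 ≤ 1 / (m : ℝ) := by positivity
  have hT : MeasurableSet (tripleCube P) := measurableSet_axisCube _ _
  set k : ℤ := P.1 - j
  have hside : ENNReal.ofReal (2 * (2 * (2 : ℝ) ^ k)) ^ n = 4 ^ n * (2 : ℝ≥0∞) ^ ((k : ℝ) * n) := by
    rw [← mul_assoc, ENNReal.ofReal_mul (by norm_num), ENNReal.ofReal_two_zpow, mul_pow,
      ENNReal.rpow_mul, ENNReal.rpow_natCast]
    norm_num
  have hprod : ∫⁻ x, ∏ l, ν l (centredCube x (2 * (2 : ℝ) ^ k) ∩ tripleCube P) ^ (1 / (m : ℝ)) ≤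
      4 ^ n * (2 : ℝ≥0∞) ^ ((k : ℝ) * n) * ∏ l, ν l (tripleCube P) ^ (1 / (m : ℝ)) := by
    refine (ENNReal.lintegral_prod_norm_pow_le Finset.univ
      (fun l _ => (measurable_measure_centredCube_inter (ν l) _ hT).aemeasurable)
      (p := fun _ => 1 / (m : ℝ)) (by simp [hm0.ne']) fun _ _ => hmi).trans ?_
    calc _ ≤ ∏ l, (4 ^ n * (2 : ℝ≥0∞) ^ ((k : ℝ) * n) * ν l (tripleCube P)) ^ (1 / (m : ℝ)) := by
          gcongr with l
          exact (lintegral_measure_centredCube_inter_le (ν l) _ hT).trans_eq (by rw [hside])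
      _ = _ := by
          simp_rw [ENNReal.mul_rpow_of_nonneg _ _ hmi, Finset.prod_mul_distrib]
          simp only [Finset.prod_const, Finset.card_univ, Fintype.card_fin]
          congr 1
          rw [← mul_pow, ← ENNReal.mul_rpow_of_nonneg _ _ hmi, ← ENNReal.rpow_natCast,
            ← ENNReal.rpow_mul, one_div_mul_cancel hm0.ne', ENNReal.rpow_one]
  unfold generationMajorant
  rw [lintegral_const_mul _ (Finset.measurable_prod _ fun l _ =>
    (measurable_measure_centredCube_inter (ν l) _ hT).pow_const _)]
  refine (mul_le_mul_right hprod _).trans_eq ?_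
  rw [volume_dyadicCube, ENNReal.ofReal_two_zpow, dyadicCoeff,
    ENNReal.mul_rpow_of_nonneg _ _ hmi, ← ENNReal.rpow_mul, ← ENNReal.prod_rpow_of_nonneg hmi,
    ← ENNReal.rpow_natCast 4 n, ← ENNReal.rpow_natCast _ n, ← ENNReal.rpow_natCast _ j,
    ← ENNReal.rpow_mul, ← ENNReal.rpow_mul]
  set D := ∏ l, ν l (tripleCube P) ^ (1 / (m : ℝ))
  have e : (2 : ℝ≥0∞) ^ (-((k : ℝ) * β) * (1 / (m : ℝ))) * (2 : ℝ≥0∞) ^ ((k : ℝ) * n) =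
      (2 : ℝ≥0∞) ^ (-(n - β / m) * j) * ((2 : ℝ≥0∞) ^ ((P.1 : ℝ) * n) *
        (2 : ℝ≥0∞) ^ (-((P.1 : ℝ) * β) * (1 / (m : ℝ)))) := by
    rw [← ENNReal.two_rpow_add, ← ENNReal.two_rpow_add, ← ENNReal.two_rpow_add]
    congr 1
    simp only [k]
    push_cast
    field_simp
    ring
  calc _ = (4 : ℝ≥0∞) ^ (n : ℝ) * ((2 : ℝ≥0∞) ^ (-((k : ℝ) * β) * (1 / (m : ℝ))) *
        (2 : ℝ≥0∞) ^ ((k : ℝ) * n)) * D := by ring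
    _ = _ := by rw [e]; ring

/-- **Local estimate.** Below a dyadic cube `P` the dyadic model operator has an `L^{1/m}` norm on
`P` controlled by the coefficient of `P` alone. -/
theorem setLIntegral_familySum_rpow_le [∀ l, SFinite (ν l)] (hm : 0 < m)
    (F : Finset (ℤ × (Fin n → ℤ))) (P : ℤ × (Fin n → ℤ)) :
    ∫⁻ x in dyadicCube P,
        familySum dyadicCube (dyadicCoeff β ν) {i ∈ F | i.1 ≤ P.1} x ^ (1 / (m : ℝ)) ≤
      4 ^ n * (1 - (2 : ℝ≥0∞) ^ (-(n - β / m)))⁻¹ *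
        (volume (dyadicCube P) * dyadicCoeff β ν P ^ (1 / (m : ℝ))) := by
  calc _ ≤ ∫⁻ x in dyadicCube P, ∑' j, generationMajorant β ν P j x := by
        refine setLIntegral_mono' (measurableSet_dyadicCube P) fun x hx => ?_
        convert familySum_rpow_le_tsum_generationMajorant hm F hx
    _ ≤ ∫⁻ x, ∑' j, generationMajorant β ν P j x := setLIntegral_le_lintegral _ _
    _ = ∑' j, ∫⁻ x, generationMajorant β ν P j x :=
        lintegral_tsum fun j => (measurable_generationMajorant P j).aemeasurable
    _ ≤ ∑' j, 4 ^ n * ((2 : ℝ≥0∞) ^ (-(n - β / m))) ^ j *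
        (volume (dyadicCube P) * dyadicCoeff β ν P ^ (1 / (m : ℝ))) :=
        ENNReal.tsum_le_tsum fun j => lintegral_generationMajorant_le hm P j
    _ = _ := by rw [ENNReal.tsum_mul_right, ENNReal.tsum_mul_left, ENNReal.tsum_geometric]

end

/-- Chebyshev's inequality turns the local estimate into a decay of level sets, with a threshold
`κ` that does not depend on the measures. -/
theorem exists_volume_familySum_le {m n : ℕ} (hm : 0 < m) {β : ℝ} (hβ : β < (m : ℝ) * n) :
    ∃ κ : ℝ, 0 < κ ∧ ∀ (ν : Fin m → Measure (EuclideanSpace ℝ (Fin n))), (∀ l, SFinite (ν l)) →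
      ∀ (F : Finset (ℤ × (Fin n → ℤ))) (P : ℤ × (Fin n → ℤ)) (t : ℝ), 0 < t →
        dyadicCoeff β ν P ≤ ENNReal.ofReal (κ * t) →
          volume (dyadicCube P ∩ {x | ENNReal.ofReal t <
            familySum dyadicCube (dyadicCoeff β ν) {i ∈ F | i.1 ≤ P.1} x}) ≤
              volume (dyadicCube P) / 2 := by
  have hm0 : (0 : ℝ) < m := by exact_mod_cast hm
  have hmi : 0 < 1 / (m : ℝ) := by positivity
  set C : ℝ≥0∞ := 4 ^ n * (1 - (2 : ℝ≥0∞) ^ (-(n - β / m)))⁻¹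
  have hC : C ≠ ∞ := by
    refine ENNReal.mul_ne_top (ENNReal.pow_ne_top ENNReal.ofNat_ne_top) ?_
    rw [ENNReal.inv_ne_top, ne_eq, tsub_eq_zero_iff_le, not_le]
    refine ENNReal.rpow_lt_one_of_one_lt_of_neg ENNReal.one_lt_two ?_
    -- The ratio of the geometric series is below `1` because `β < m n`.
    rw [neg_lt_zero, sub_pos, div_lt_iff₀ hm0, mul_comm]
    exact hβ
  set C' : ℝ := C.toReal + 1
  have hC'0 : 0 < C' := by positivity
  have hCC' : C ≤ ENNReal.ofReal C' := by
    rw [ENNReal.ofReal_add (by positivity) zero_le_one, ENNReal.ofReal_toReal hC]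
    exact le_self_add
  -- This `κ` makes `C * κ ^ (1 / m)` at most `1 / 2`.
  refine ⟨(1 / (2 * C')) ^ m, by positivity, fun ν _ F P t ht hP => ?_⟩
  set L := familySum dyadicCube (dyadicCoeff β ν) {i ∈ F | i.1 ≤ P.1}
  have hL : Measurable L := measurable_familySum measurableSet_dyadicCube _
  have h1 := (mul_meas_ge_le_lintegral (μ := volume.restrict (dyadicCube P))
    (hL.pow_const (1 / (m : ℝ))) (ENNReal.ofReal t ^ (1 / (m : ℝ)))).trans
      (setLIntegral_familySum_rpow_le hm F P)
  have ht0 : ENNReal.ofReal t ^ (1 / (m : ℝ)) ≠ 0 := by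
    simp [ENNReal.rpow_eq_zero_iff, ht]
  have ht1 : ENNReal.ofReal t ^ (1 / (m : ℝ)) ≠ ∞ :=
    ENNReal.rpow_ne_top_of_nonneg hmi.le ENNReal.ofReal_ne_top
  have hcoef : C * dyadicCoeff β ν P ^ (1 / (m : ℝ)) ≤ ENNReal.ofReal t ^ (1 / (m : ℝ)) * 2⁻¹ := by
    calc C * dyadicCoeff β ν P ^ (1 / (m : ℝ))
        ≤ ENNReal.ofReal C' * ENNReal.ofReal ((1 / (2 * C')) ^ m * t) ^ (1 / (m : ℝ)) := by gcongr
      _ = ENNReal.ofReal C' *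
            (ENNReal.ofReal (1 / (2 * C')) * ENNReal.ofReal t ^ (1 / (m : ℝ))) := by
          rw [ENNReal.ofReal_mul (by positivity), ENNReal.mul_rpow_of_nonneg _ _ hmi.le,
            ENNReal.ofReal_pow (by positivity), ← ENNReal.rpow_natCast, ← ENNReal.rpow_mul,
            mul_one_div_cancel hm0.ne', ENNReal.rpow_one]
      _ = ENNReal.ofReal t ^ (1 / (m : ℝ)) * ENNReal.ofReal (C' * (1 / (2 * C'))) := by
          rw [ENNReal.ofReal_mul hC'0.le]; ring
      _ = _ := by
          have : C' * (1 / (2 * C')) = 2⁻¹ := by field_simp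
          rw [this, ENNReal.ofReal_inv_of_pos two_pos]; simp
  rw [← ENNReal.mul_le_mul_iff_right ht0 ht1]
  calc _ ≤ ENNReal.ofReal t ^ (1 / (m : ℝ)) * (volume.restrict (dyadicCube P))
        {x | ENNReal.ofReal t ^ (1 / (m : ℝ)) ≤ L x ^ (1 / (m : ℝ))} := by
        rw [Measure.restrict_apply' (measurableSet_dyadicCube P), Set.inter_comm]
        gcongr with x
        exact fun hx => ENNReal.rpow_le_rpow (le_of_lt hx) hmi.le
    _ ≤ C * (volume (dyadicCube P) * dyadicCoeff β ν P ^ (1 / (m : ℝ))) := h1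
    _ = (C * dyadicCoeff β ν P ^ (1 / (m : ℝ))) * volume (dyadicCube P) := by ring
    _ ≤ (ENNReal.ofReal t ^ (1 / (m : ℝ)) * 2⁻¹) * volume (dyadicCube P) := by gcongr
    _ = _ := by rw [ENNReal.div_eq_inv_mul, mul_assoc]

/-! ### Weighted bounds for the dyadic model operator -/

section
variable {n : ℕ} {ω : EuclideanSpace ℝ (Fin n) → ℝ}

theorem weightMeasure_dyadicCube (i : ℤ × (Fin n → ℤ)) :
    weightMeasure ω (dyadicCube i) =
      weightMeasure ω (axisCube (WithLp.toLp 2 fun j => (2 : ℝ) ^ i.1 * i.2 j) ((2 : ℝ) ^ i.1)) :=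
  measure_congr ((withDensity_absolutelyContinuous _ _).ae_eq (dyadicCube_ae_eq_axisCube i))

/-- **The dyadic inequality.** The finite dyadic model operators are controlled by their maximal
operators, with a constant independent of the measures and of the finite family. -/
theorem IsAInftyWeight.exists_familySum_bounds (hω : IsAInftyWeight ω) {m : ℕ} (hm : 0 < m)
    {β : ℝ} (hβ : β < (m : ℝ) * n) {q : ℝ} (hq : 0 < q) :
    ∃ C : ℝ, 0 < C ∧ ∀ (ν : Fin m → Measure (EuclideanSpace ℝ (Fin n))), (∀ l, SFinite (ν l)) →
      (∀ l i, ν l (tripleCube i) ≠ ∞) → ∀ F : Finset (ℤ × (Fin n → ℤ)),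
        ∫⁻ x, familySum dyadicCube (dyadicCoeff β ν) F x ^ q ∂(weightMeasure ω) ≤
          ENNReal.ofReal C *
            ∫⁻ x, familyMax dyadicCube (dyadicCoeff β ν) F x ^ q ∂(weightMeasure ω) ∧
        weakQuasinormPow q (familySum dyadicCube (dyadicCoeff β ν) F) (weightMeasure ω) ≤
          ENNReal.ofReal C *
            weakQuasinormPow q (familyMax dyadicCube (dyadicCoeff β ν) F) (weightMeasure ω) := by
  obtain ⟨θ, hθ0, hθ1, hθ⟩ := hω.exists_measure_le
  obtain ⟨κ, hκ0, hκ⟩ := exists_volume_familySum_le (n := n) hm hβ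
  -- The gain `1 - θ` is only slightly below `1`, so the ratio `a` of consecutive levels is taken
  -- so close to `1` that `a ^ q * (1 - θ) = 1 - θ ^ 2`.
  set a : ℝ := (1 + θ) ^ (1 / q)
  have ha1 : 1 < a := Real.one_lt_rpow (by linarith) (by positivity)
  have haq : a ^ q = 1 + θ := by
    rw [← Real.rpow_mul (by linarith), one_div_mul_cancel hq.ne', Real.rpow_one]
  have hs : 0 < a - 1 := by linarith
  have hγ : 0 < κ * (a - 1) := by positivity
  refine ⟨1 / θ ^ 2 * (a / (κ * (a - 1))) ^ q, by positivity, fun ν hνs hν F => ?_⟩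
  have hc := dyadicCoeff_ne_top (β := β) hν
  have hQ : ∀ i : ℤ × (Fin n → ℤ), MeasurableSet (dyadicCube i) := measurableSet_dyadicCube
  have hωQ : ∀ i : ℤ × (Fin n → ℤ), weightMeasure ω (dyadicCube i) ≠ ∞ := fun i => by
    rw [weightMeasure_dyadicCube]
    obtain ⟨p, _, hp⟩ := hω
    exact weightMeasure_axisCube_ne_top hp.locallyIntegrable _ _
  refine goodLambda_bounds (measurable_familySum hQ F) (measurable_familyMax hQ F)
    (familySum_ne_top hc F) (familyMax_ne_top hc F) hq
    (lintegral_familySum_rpow_ne_top hQ hc hωQ F hq) (by linarith) hγ (ε := 1 - θ)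
    (by positivity) (by nlinarith) (by rw [haq]; nlinarith) fun t ht => ?_
  have := isNested_dyadicCube.goodLambda (μ := weightMeasure ω) (c := dyadicCoeff β ν) hQ F
    (ε := ENNReal.ofReal (1 - θ)) (κ := κ) (fun P _ t ht hP => ?_) hs ht
  · rwa [add_sub_cancel] at this
  · rw [weightMeasure_dyadicCube P]
    refine hθ _ _ (by positivity) _ (Set.inter_subset_left.trans (dyadicCube_subset_axisCube P))
      ((hQ P).inter (measurableSet_lt measurable_const (measurable_familySum hQ _))) ?_
    rw [← measure_congr (dyadicCube_ae_eq_axisCube P)]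
    convert hκ ν hνs F P t ht hP

/-- Passage from finite families to all dyadic cubes, by monotone convergence. -/
theorem IsAInftyWeight.exists_iSup_familySum_bounds (hω : IsAInftyWeight ω) {m : ℕ} (hm : 0 < m)
    {β : ℝ} (hβ : β < (m : ℝ) * n) {q : ℝ} (hq : 0 < q) {b : ℝ} (hb : 0 < b) :
    ∃ C : ℝ, 0 < C ∧ ∀ (ν : Fin m → Measure (EuclideanSpace ℝ (Fin n))), (∀ l, SFinite (ν l)) →
      (∀ l i, ν l (tripleCube i) ≠ ∞) → ∀ M : EuclideanSpace ℝ (Fin n) → ℝ≥0∞,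
        (∀ F x, familyMax dyadicCube (dyadicCoeff β ν) F x ≤ ENNReal.ofReal b * M x) →
        ∫⁻ x, (⨆ F, familySum dyadicCube (dyadicCoeff β ν) F x) ^ q ∂(weightMeasure ω) ≤
          ENNReal.ofReal C * ∫⁻ x, M x ^ q ∂(weightMeasure ω) ∧
        weakQuasinormPow q (fun x => ⨆ F, familySum dyadicCube (dyadicCoeff β ν) F x)
            (weightMeasure ω) ≤
          ENNReal.ofReal C * weakQuasinormPow q M (weightMeasure ω) := by
  classical
  obtain ⟨C, hC, h⟩ := hω.exists_familySum_bounds hm hβ hq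
  refine ⟨C * b ^ q, by positivity, fun ν hνs hν M hM => ?_⟩
  have hfac : ENNReal.ofReal (C * b ^ q) = ENNReal.ofReal C * ENNReal.ofReal b ^ q := by
    rw [ENNReal.ofReal_mul hC.le, ENNReal.ofReal_rpow_of_pos hb]
  have hmeas : ∀ F, Measurable (familySum dyadicCube (dyadicCoeff β ν) F) :=
    measurable_familySum measurableSet_dyadicCube
  rw [hfac]
  constructor
  · have hpow : ∀ x, (⨆ F, familySum dyadicCube (dyadicCoeff β ν) F x) ^ q =
        ⨆ F, familySum dyadicCube (dyadicCoeff β ν) F x ^ q := fun x =>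
      (ENNReal.orderIsoRpow q hq).map_iSup _
    simp only [hpow]
    rw [lintegral_iSup_directed (fun F => ((hmeas F).pow_const q).aemeasurable)]
    · refine iSup_le fun F => (h ν hνs hν F).1.trans ?_
      rw [mul_assoc]
      gcongr
      exact lintegral_rpow_le_of_le_mul hq.le (hM F)
    · exact directed_of_isDirected_le fun F G hFG x =>
        ENNReal.rpow_le_rpow (familySum_mono hFG x) hq.le
  · refine iSup₂_le fun t ht => ?_
    have hset : {x | ENNReal.ofReal t < ⨆ F, familySum dyadicCube (dyadicCoeff β ν) F x} =
        ⋃ F, {x | ENNReal.ofReal t < familySum dyadicCube (dyadicCoeff β ν) F x} := by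
      ext x; simp [lt_iSup_iff]
    have hdir : Directed (· ⊆ ·) fun F =>
        {x | ENNReal.ofReal t < familySum dyadicCube (dyadicCoeff β ν) F x} :=
      directed_of_isDirected_le fun F G hFG x hx =>
        lt_of_lt_of_le (b := familySum dyadicCube (dyadicCoeff β ν) F x) hx (familySum_mono hFG x)
    rw [hset, hdir.measure_iUnion, ENNReal.mul_iSup]
    refine iSup_le fun F => ?_
    calc _ ≤ weakQuasinormPow q (familySum dyadicCube (dyadicCoeff β ν) F) (weightMeasure ω) :=
          le_iSup₂ (f := fun (t : ℝ) (_ : 0 < t) => ENNReal.ofReal t ^ q *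
            weightMeasure ω {x | ENNReal.ofReal t <
              familySum dyadicCube (dyadicCoeff β ν) F x}) t ht
      _ ≤ _ := (h ν hνs hν F).2
      _ ≤ _ := by
        rw [mul_assoc]
        gcongr
        exact weakQuasinormPow_le_of_le_mul hq.le hb (hM F)

end

/-! ### Comparison of the fractional operators with the dyadic ones -/

/-- **Tonelli's theorem** for a product of functions of separate variables. -/
theorem lintegral_fin_prod_eq_prod_lintegral {X : Type*} [MeasureSpace X]
    [SigmaFinite (volume : Measure X)] {m : ℕ} {g : Fin m → X → ℝ≥0∞}
    (hg : ∀ i, AEMeasurable (g i) volume) :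
    ∫⁻ y : Fin m → X, ∏ i, g i (y i) = ∏ i, ∫⁻ u, g i u := by
  induction m with
  | zero => simp [volume_pi]
  | succ m ih =>
    have hmp := (volume_preserving_piFinSuccAbove (fun _ : Fin (m + 1) => X) 0).symm
    have htail : AEMeasurable (fun y : Fin m → X => ∏ i : Fin m, g i.succ (y i)) volume :=
      Finset.aemeasurable_fun_prod _ fun i _ =>
        (hg i.succ).comp_quasiMeasurePreserving
          (Measure.quasiMeasurePreserving_eval (fun _ => volume) i)
    rw [Fin.prod_univ_succ, ← ih (fun i => hg i.succ), ← lintegral_prod_mul (hg 0) htail,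
      ← hmp.lintegral_comp_emb (MeasurableEquiv.measurableEmbedding _)]
    refine lintegral_congr fun z => ?_
    rw [Fin.prod_univ_succ]
    rfl

section
variable {𝕜 : Type*} [RCLike 𝕜] {m n : ℕ} {α : ℝ}

/-- The measure `|g(x)| dx`. -/
noncomputable def absMeasure (g : EuclideanSpace ℝ (Fin n) → 𝕜) :
    Measure (EuclideanSpace ℝ (Fin n)) :=
  volume.withDensity fun x => ‖g x‖ₑ

instance (g : EuclideanSpace ℝ (Fin n) → 𝕜) : SFinite (absMeasure g) := by
  unfold absMeasure; infer_instance

theorem absMeasure_axisCube (g : EuclideanSpace ℝ (Fin n) → 𝕜) (a : EuclideanSpace ℝ (Fin n))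
    (l : ℝ) : absMeasure g (axisCube a l) = ∫⁻ x in axisCube a l, ‖g x‖ₑ :=
  withDensity_apply _ (measurableSet_axisCube a l)

theorem absMeasure_tripleCube_ne_top {g : EuclideanSpace ℝ (Fin n) → 𝕜}
    (hg : LocallyIntegrable g volume) (i : ℤ × (Fin n → ℤ)) :
    absMeasure g (tripleCube i) ≠ ∞ := by
  rw [tripleCube, absMeasure_axisCube]
  exact (hg.integrableOn_isCompact (isCompact_axisCube _ _)).hasFiniteIntegral.ne

/-- The dyadic coefficients are, up to a constant, averages over cubes competing in the maximal
operator. -/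
theorem dyadicCoeff_le_fracMaximal (hmn : (m : ℝ) * n ≠ 0)
    (f : Fin m → EuclideanSpace ℝ (Fin n) → 𝕜) {i : ℤ × (Fin n → ℤ)}
    {x : EuclideanSpace ℝ (Fin n)} (hx : x ∈ dyadicCube i) :
    dyadicCoeff ((m : ℝ) * n - α) (fun l => absMeasure (f l)) i ≤
      ENNReal.ofReal (3 ^ ((m : ℝ) * n - α)) * fracMaximal α f x := by
  set β := (m : ℝ) * n - α with hβ
  have hl : (0 : ℝ) < 3 * 2 ^ i.1 := by positivity
  have hmax : ∏ l, (absMeasure (f l) (tripleCube i)) /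
      volume (tripleCube i) ^ (1 - α / ((m : ℝ) * n)) ≤ fracMaximal α f x := by
    simp only [tripleCube, absMeasure_axisCube]
    exact le_iSup₂_of_le _ _ (le_iSup₂_of_le hl (dyadicCube_subset_tripleCube i hx) le_rfl)
  have hvol : volume (tripleCube i) ^ (1 - α / ((m : ℝ) * n)) =
      ENNReal.ofReal (3 * 2 ^ i.1) ^ (n * (1 - α / ((m : ℝ) * n))) := by
    rw [tripleCube, volume_axisCube, ← ENNReal.rpow_natCast, ← ENNReal.rpow_mul]
  have hβm : (n * (1 - α / ((m : ℝ) * n))) * m = β := by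
    have := div_mul_cancel₀ α hmn
    rw [hβ]
    linear_combination -this
  have h3 : (ENNReal.ofReal (3 ^ β)) ≠ 0 := by
    simp only [ne_eq, ENNReal.ofReal_eq_zero, not_le]; positivity
  refine le_trans ?_ (mul_le_mul_right hmax _)
  rw [hvol]
  simp only [ENNReal.div_eq_inv_mul, Finset.prod_mul_distrib, Finset.prod_const, Finset.card_univ,
    Fintype.card_fin]
  rw [← ENNReal.inv_pow, ← ENNReal.rpow_natCast, ← ENNReal.rpow_mul, hβm, ENNReal.ofReal_mul
    (by norm_num), ENNReal.mul_rpow_of_ne_top ENNReal.ofReal_ne_top ENNReal.ofReal_ne_top,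
    ENNReal.ofReal_rpow_of_pos (by norm_num), ENNReal.ofReal_two_zpow, ← ENNReal.rpow_mul,
    ENNReal.mul_inv (Or.inl h3) (Or.inl ENNReal.ofReal_ne_top), ← ENNReal.rpow_neg, dyadicCoeff]
  refine le_of_eq ?_
  calc _ = (ENNReal.ofReal (3 ^ β) * (ENNReal.ofReal (3 ^ β))⁻¹) *
        ((2 : ℝ≥0∞) ^ (-((i.1 : ℝ) * β)) * ∏ l, absMeasure (f l) (tripleCube i)) := by
        rw [ENNReal.mul_inv_cancel h3 ENNReal.ofReal_ne_top, one_mul]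
    _ = _ := by ring

theorem familyMax_le_fracMaximal (hmn : (m : ℝ) * n ≠ 0)
    (f : Fin m → EuclideanSpace ℝ (Fin n) → 𝕜) (F : Finset (ℤ × (Fin n → ℤ)))
    (x : EuclideanSpace ℝ (Fin n)) :
    familyMax dyadicCube (dyadicCoeff ((m : ℝ) * n - α) fun l => absMeasure (f l)) F x ≤
      ENNReal.ofReal (3 ^ ((m : ℝ) * n - α)) * fracMaximal α f x := by
  refine Finset.sup_le fun i _ => ?_
  by_cases hx : x ∈ dyadicCube i
  · rw [Set.indicator_of_mem hx]
    exact dyadicCoeff_le_fracMaximal hmn f hx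
  · simp [hx]

theorem aestronglyMeasurable_fracKernel {f : Fin m → EuclideanSpace ℝ (Fin n) → 𝕜}
    (hf : ∀ l, AEStronglyMeasurable (f l) volume) (x : EuclideanSpace ℝ (Fin n)) :
    AEStronglyMeasurable (fracKernel α f x) volume := by
  have h1 : ∀ l, AEMeasurable (fun y : Fin m → EuclideanSpace ℝ (Fin n) => f l (x - y l))
      volume := fun l =>
    ((hf l).aemeasurable.comp_quasiMeasurePreserving (Measure.measurePreserving_sub_left
      volume x).quasiMeasurePreserving).comp_quasiMeasurePreserving
        (Measure.quasiMeasurePreserving_eval (fun _ => volume) l)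
  have h2 : Measurable fun y : Fin m → EuclideanSpace ℝ (Fin n) =>
      (((∑ i, ‖y i‖) ^ ((m : ℝ) * n - α) : ℝ) : 𝕜) :=
    RCLike.measurable_ofReal.comp
      ((Finset.measurable_sum _ fun i _ => (measurable_pi_apply i).norm).pow_const _)
  exact ((Finset.aemeasurable_fun_prod _ fun l _ => h1 l).div h2.aemeasurable).aestronglyMeasurable

/-- The extended value of `|I_α f|` never exceeds the integral of the absolute value of the
integrand, which is infinite exactly where there is no absolute convergence. -/
theorem fracIntegralAbs_le_lintegral {f : Fin m → EuclideanSpace ℝ (Fin n) → 𝕜}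
    (hf : ∀ l, AEStronglyMeasurable (f l) volume) (x : EuclideanSpace ℝ (Fin n)) :
    fracIntegralAbs α f x ≤ ∫⁻ y, ‖fracKernel α f x y‖ₑ := by
  unfold fracIntegralAbs
  split_ifs with h
  · exact enorm_integral_le_lintegral_enorm _
  · by_contra! hlt
    exact h ⟨aestronglyMeasurable_fracKernel hf x, hlt⟩

/-- Decomposition of the kernel into dyadic shells `|y_1| + ⋯ + |y_m| ~ 2 ^ k`. At `y = 0` the
kernel vanishes by the convention for division by zero. -/
theorem enorm_fracKernel_le (hα : α < (m : ℝ) * n) (f : Fin m → EuclideanSpace ℝ (Fin n) → 𝕜)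
    (x : EuclideanSpace ℝ (Fin n)) (y : Fin m → EuclideanSpace ℝ (Fin n)) :
    ‖fracKernel α f x y‖ₑ ≤ ∑' k : ℤ, ENNReal.ofReal (2 ^ ((m : ℝ) * n - α)) *
      ((2 : ℝ≥0∞) ^ (-((k : ℝ) * ((m : ℝ) * n - α))) *
        ∏ l, (centredCube x ((2 : ℝ) ^ k)).indicator (fun u => ‖f l u‖ₑ) (x - y l)) := by
  set β := (m : ℝ) * n - α with hβ
  have hβ0 : 0 < β := sub_pos.2 hα
  have hr0 : 0 ≤ ∑ i, ‖y i‖ := Finset.sum_nonneg fun i _ => norm_nonneg _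
  rcases hr0.eq_or_lt with hr | hr
  · simp [fracKernel, ← hr, ← hβ, Real.zero_rpow hβ0.ne']
  obtain ⟨k, hk1, hk2⟩ := _root_.exists_mem_Ioc_zpow hr one_lt_two
  refine le_trans ?_ (ENNReal.le_tsum (k + 1))
  have hmem : ∀ l, x - y l ∈ centredCube x ((2 : ℝ) ^ (k + 1)) := fun l =>
    mem_centredCube.2 fun j => by
      have h1 : |(x - y l) j - x j| = ‖y l j‖ := by simp
      rw [h1]
      exact (PiLp.norm_apply_le (y l) j).trans
        ((Finset.single_le_sum (fun i _ => norm_nonneg (y i)) (Finset.mem_univ l)).trans hk2)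
  simp only [Set.indicator_of_mem (hmem _)]
  have hrβ : 0 < (∑ i, ‖y i‖) ^ β := Real.rpow_pos_of_pos hr β
  have hne : (((∑ i, ‖y i‖) ^ β : ℝ) : 𝕜) ≠ 0 := by exact_mod_cast hrβ.ne'
  have hden : ‖(((∑ i, ‖y i‖) ^ β : ℝ) : 𝕜)‖ₑ = ENNReal.ofReal (∑ i, ‖y i‖) ^ β := by
    rw [← ofReal_norm, RCLike.norm_ofReal, abs_of_pos hrβ, ENNReal.ofReal_rpow_of_pos hr]
  have hnum : ‖∏ l, f l (x - y l)‖ₑ = ∏ l, ‖f l (x - y l)‖ₑ := by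
    simp only [enorm_eq_nnnorm, nnnorm_prod, ENNReal.ofNNReal_finsetProd]
  rw [fracKernel, ← hβ, div_eq_mul_inv, enorm_mul, enorm_inv hne, hden, hnum, mul_comm,
    ← mul_assoc]
  gcongr
  have h2 : ENNReal.ofReal (2 ^ β) = (2 : ℝ≥0∞) ^ β := by
    rw [← ENNReal.ofReal_rpow_of_pos two_pos]; simp
  rw [h2, ← ENNReal.two_rpow_add, ← ENNReal.rpow_neg]
  have e : β + -(((k + 1 : ℤ) : ℝ) * β) = (k : ℝ) * -β := by push_cast; ring
  rw [e, ENNReal.rpow_mul, ← ENNReal.ofReal_two_zpow]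
  rw [ENNReal.rpow_neg, ENNReal.rpow_neg, ENNReal.inv_le_inv]
  exact ENNReal.rpow_le_rpow (ENNReal.ofReal_le_ofReal hk1.le) hβ0.le

/-- The multilinear fractional integral is dominated by the dyadic model operator. -/
theorem fracIntegralAbs_le_iSup_familySum (hα : α < (m : ℝ) * n)
    {f : Fin m → EuclideanSpace ℝ (Fin n) → 𝕜} (hf : ∀ l, AEStronglyMeasurable (f l) volume)
    (x : EuclideanSpace ℝ (Fin n)) :
    fracIntegralAbs α f x ≤ ENNReal.ofReal (2 ^ ((m : ℝ) * n - α)) *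
      ⨆ F, familySum dyadicCube (dyadicCoeff ((m : ℝ) * n - α) fun l => absMeasure (f l)) F x := by
  set β := (m : ℝ) * n - α
  have hind : ∀ (k : ℤ) l, AEMeasurable
      (fun u => (centredCube x ((2 : ℝ) ^ k)).indicator (fun u => ‖f l u‖ₑ) (x - u)) volume :=
    fun k l => ((hf l).enorm.indicator (measurableSet_axisCube _ _)).comp_quasiMeasurePreserving
      (Measure.measurePreserving_sub_left volume x).quasiMeasurePreserving
  have hterm : ∀ k : ℤ, ∫⁻ y : Fin m → EuclideanSpace ℝ (Fin n),
      ∏ l, (centredCube x ((2 : ℝ) ^ k)).indicator (fun u => ‖f l u‖ₑ) (x - y l) =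
        ∏ l, absMeasure (f l) (centredCube x ((2 : ℝ) ^ k)) := by
    intro k
    rw [lintegral_fin_prod_eq_prod_lintegral
      (g := fun l u => (centredCube x ((2 : ℝ) ^ k)).indicator (fun u => ‖f l u‖ₑ) (x - u))
      (hind k)]
    refine Finset.prod_congr rfl fun l _ => ?_
    rw [lintegral_sub_left_eq_self (fun u =>
      (centredCube x ((2 : ℝ) ^ k)).indicator (fun u => ‖f l u‖ₑ) u),
      centredCube, lintegral_indicator (measurableSet_axisCube _ _), absMeasure_axisCube]
  have hprod : ∀ k : ℤ, AEMeasurable (fun y : Fin m → EuclideanSpace ℝ (Fin n) =>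
      ∏ l, (centredCube x ((2 : ℝ) ^ k)).indicator (fun u => ‖f l u‖ₑ) (x - y l)) volume :=
    fun k => Finset.aemeasurable_fun_prod _ fun l _ =>
      (hind k l).comp_quasiMeasurePreserving
        (Measure.quasiMeasurePreserving_eval (fun _ => volume) l)
  calc fracIntegralAbs α f x ≤ ∫⁻ y, ‖fracKernel α f x y‖ₑ := fracIntegralAbs_le_lintegral hf x
    _ ≤ _ := lintegral_mono (enorm_fracKernel_le hα f x)
    _ = ENNReal.ofReal (2 ^ β) * ∑' k : ℤ, (2 : ℝ≥0∞) ^ (-((k : ℝ) * β)) *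
          ∏ l, absMeasure (f l) (centredCube x ((2 : ℝ) ^ k)) := by
        rw [lintegral_tsum fun k => ((hprod k).const_mul _).const_mul _, ← ENNReal.tsum_mul_left]
        refine tsum_congr fun k => ?_
        rw [lintegral_const_mul'' _ ((hprod k).const_mul _), lintegral_const_mul'' _ (hprod k),
          hterm k]
    _ ≤ _ := by
        gcongr
        simp only [familySum]
        rw [← ENNReal.tsum_eq_iSup_sum]
        -- At each scale `x` lies in exactly one dyadic cube.
        refine le_trans ?_ (ENNReal.tsum_comp_le_tsum_of_injective
          (f := fun k : ℤ => (k, fun j => ⌊x j / (2 : ℝ) ^ k⌋))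
          (fun k k' h => congrArg Prod.fst h) _)
        refine ENNReal.tsum_le_tsum fun k => ?_
        rw [Set.indicator_of_mem (exists_mem_dyadicCube k x), dyadicCoeff]
        gcongr with l
        exact centredCube_subset_tripleCube (exists_mem_dyadicCube k x)

end

theorem proposition5p1 {𝕜 : Type*} [RCLike 𝕜] (m n : ℕ) (q α : ℝ) (hq : 0 < q)
    (hα : 0 < α) (hαmn : α < (m : ℝ) * n)
    (ω : EuclideanSpace ℝ (Fin n) → ℝ) (hω : IsAInftyWeight ω) :
    ∃ C : ℝ, 0 < C ∧
      ∀ f : Fin m → EuclideanSpace ℝ (Fin n) → 𝕜, (∀ i, LocallyIntegrable (f i) volume) →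
        (∫⁻ x, fracIntegralAbs α f x ^ q ∂(weightMeasure ω) ≤
            ENNReal.ofReal C * ∫⁻ x, fracMaximal α f x ^ q ∂(weightMeasure ω)) ∧
          weakQuasinormPow q (fracIntegralAbs α f) (weightMeasure ω) ≤
            ENNReal.ofReal C * weakQuasinormPow q (fracMaximal α f) (weightMeasure ω) := by
  have hmn : (m : ℝ) * n ≠ 0 := (hα.trans hαmn).ne'
  have hm : 0 < m := Nat.pos_of_ne_zero fun h => hmn (by simp [h])
  have hβ : (m : ℝ) * n - α < (m : ℝ) * n := by linarith
  obtain ⟨C, hC, h⟩ := hω.exists_iSup_familySum_bounds hm hβ hq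
    (b := 3 ^ ((m : ℝ) * n - α)) (by positivity)
  have h2 : (0 : ℝ) < 2 ^ ((m : ℝ) * n - α) := by positivity
  refine ⟨(2 ^ ((m : ℝ) * n - α)) ^ q * C, by positivity, fun f hf => ?_⟩
  obtain ⟨hstrong, hweak⟩ := h (fun l => absMeasure (f l)) (fun l => inferInstance)
    (fun l => absMeasure_tripleCube_ne_top (hf l)) (fracMaximal α f)
    (familyMax_le_fracMaximal hmn f)
  have hdom := fracIntegralAbs_le_iSup_familySum hαmn fun l => (hf l).aestronglyMeasurable
  rw [ENNReal.ofReal_mul (by positivity), ← ENNReal.ofReal_rpow_of_pos h2, mul_assoc, mul_assoc]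
  exact ⟨(lintegral_rpow_le_of_le_mul hq.le hdom).trans (by gcongr),
    (weakQuasinormPow_le_of_le_mul hq.le h2 hdom).trans (by gcongr)⟩
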